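/- Let $d=-A^{-2}-A^{2}$, and let the Kauffman bracket of a link diagram be given by $\langle D\rangle=A\langle D_+\rangle+A^{-1}\langle D_-\rangle$ (positive and negative smoothing of a crossing) and by the value $d^{n-1}$ on $n\ge 1$ disjoint simple closed curves. Let $G$ be a finite connected plane multigraph with $k$ edges $e_1,\dots,e_k$, each of which is colored as a chain or as a sheaf. For $t\in\mathbb Z^k$ let $D_t$ be the link diagram that corresponds (by the checkerboard construction, vertices being the shaded regions and edges the crossings) to the signed plane graph obtained from $G$ by replacing each chain $e_i$ by a path of $|t_i|$ edges, and each sheaf $e_i$ by $|t_i|$ parallel edges, all of the sign of $t_i$. (For $t_i=0$ the crossings of $e_i$ are replaced by two parallel arcs, which merge the two shaded regions at the ends of $e_i$ if $e_i$ is a chain, and separate them if $e_i$ is a sheaf.) A positive edge is one whose positive smoothing merges the two shaded regions. For a spanning tree $F$ of $G$ let $p_F=\#\{\text{sheaves in }F\}+\#\{\text{chains not in }F\}$, and let $p=\max_F p_F$. For a Laurent polynomial $f\in\mathbb C[A^{\pm1}]$ let $M(f)=\exp\int_0^1\log|f(e^{2\pi i\theta})|\,d\theta$ be its Mahler measure (with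 $M(0)=0$) and $\|f\|=\bigl(\int_0^1|f(e^{2\pi i\theta})|^2\,d\theta\bigr)^{1/2}$ its $L^2$ norm. Then $d$ is cyclotomic up to a unit ($A^2d=-\Phi_8(A)$), and there is a constant $C>0$, independent of $t$, such that for all $t\in\mathbb Z^k$ $$M(\langle D_t\rangle)=M(d^p\langle D_t\rangle)\le\|d^p\langle D_t\rangle\|<C,$$ where the inequality $M(d^p\langle D_t\rangle)\le\|d^p\langle D_t\rangle\|$ is strict whenever $p\ge1$. Moreover, $p\le k$; and $p$ is at most the twist number of the diagram $D_t$ (the number of twist equivalence classes of its crossings), whenever all $t_i$ are nonzero and any two twist equivalent crossings of $D_t$ come from the same edge of $G$. In particular, if such a $D_t$ realizes the twist number of its link, then $p$ is at most the twist number of that link. -/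

import Mathlib

open scoped LaurentPolynomial

noncomputable section

/-! ### Link diagrams and the Kauffman bracket -/

/-- A (possibly disconnected) link diagram, as a rotation system with over/under information.

* Each crossing `x` has four half-edges `(x, 0), (x, 1), (x, 2), (x, 3)`, listed counterclockwise;
  the strand through `0, 2` passes under the strand through `1, 3`.
* Each joint `j` is a two-valent point on a strand, with half-edges `(j, false), (j, true)`.
  Joints carry no information, except that they make crossingless circles possible.
* `glue` says which half-edges are the two halves of one arc.

The diagram is drawn on the closed oriented surface determined by the rotation system; it is a diagram
in the plane (sphere) if that surface has genus zero, as for all diagrams built from plane graphs. -/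
structure LinkDiagram where
  Crossing : Type
  Joint : Type
  [fintypeCrossing : Fintype Crossing]
  [fintypeJoint : Fintype Joint]
  glue : (Crossing × Fin 4 ⊕ Joint × Bool) → (Crossing × Fin 4 ⊕ Joint × Bool)
  glue_glue : ∀ h, glue (glue h) = h
  glue_ne : ∀ h, glue h ≠ h

namespace LinkDiagram

attribute [instance] LinkDiagram.fintypeCrossing LinkDiagram.fintypeJoint

/-- The half-edges of a diagram. -/
abbrev HalfEdge (D : LinkDiagram) : Type := D.Crossing × Fin 4 ⊕ D.Joint × Bool

/-- Rotating the over strand of a crossing counterclockwise sweeps out the corners between `1, 2`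
and between `3, 0`. The positive smoothing (`true`) merges these two corners, hence joins `0` to `1`
and `2` to `3`; the negative smoothing (`false`) joins `1` to `2` and `3` to `0`. -/
def smoothing : Bool → Fin 4 → Fin 4
  | true => ![1, 0, 3, 2]
  | false => ![3, 2, 1, 0]

variable (D : LinkDiagram)

/-- How half-edges meeting at the same crossing or joint are connected
once every crossing `x` is smoothed according to `s x`. -/
def connect (s : D.Crossing → Bool) : D.HalfEdge → D.HalfEdge
  | .inl (x, a) => .inl (x, smoothing (s x) a)
  | .inr (j, b) => .inr (j, !b)

/-- The number of disjoint simple closed curves in the state `s`. -/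
def loops (s : D.Crossing → Bool) : ℕ :=
  Nat.card (Quot fun g h : D.HalfEdge => h = D.glue g ∨ h = D.connect s g)

/-- `d = -A⁻² - A²`. -/
def _root_.kauffmanD : ℂ[T;T⁻¹] := -LaurentPolynomial.T (-2) - LaurentPolynomial.T 2

open Classical in
/-- The Kauffman bracket (in the variable `A = T`) of a nonempty diagram: every crossing is expanded
by `⟨D⟩ = A ⟨D₊⟩ + A⁻¹ ⟨D₋⟩`, and `n` disjoint circles contribute `d ^ (n - 1)`. -/
def bracket : ℂ[T;T⁻¹] :=
  ∑ s : D.Crossing → Bool,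
    (∏ x, LaurentPolynomial.T (if s x then 1 else -1)) * kauffmanD ^ (D.loops s - 1)

/-- The next half-edge counterclockwise around the same crossing or joint. -/
def next : D.HalfEdge → D.HalfEdge
  | .inl (x, a) => .inl (x, a + 1)
  | .inr (j, b) => .inr (j, !b)

/-- The faces of a connected diagram. A half-edge `h` stands for the corner between `h` and
`next h`, that is, on the left of `h` as one leaves along `h`. Following the arc that starts with
`g` to its other end `glue g`, the corner on the same side of the arc is the `h` with
`next h = glue g`. -/
def Face : Type := Quot fun g h : D.HalfEdge => D.next h = D.glue g

/-- The face in which the corner of the crossing `x` between its half-edges `a`, `a + 1` lies. -/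
def face (x : D.Crossing) (a : Fin 4) : D.Face := Quot.mk _ (.inl (x, a))

/-- Two crossings of a connected diagram are twist equivalent if some circle in the plane meets the
diagram in these two crossings only, passing through each of them between opposite corners. -/
def TwistEquivalent (x y : D.Crossing) : Prop :=
  ∃ a b : Fin 4, D.face x a = D.face y b ∧ D.face x (a + 2) = D.face y (b + 2)

/-- The twist number of a connected diagram: the number of twist equivalence classes. -/
def twistNumber : ℕ := Nat.card (Quot D.TwistEquivalent)

end LinkDiagram

/-! ### Colored plane graphs -/

/-- The two colors of the edges of a template: `chain` is `c`, `sheaf` is `s`. -/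
inductive TwistColor
  | chain
  | sheaf

/-- A finite multigraph with `k` edges (loops and multiple edges allowed) and a rotation system.
The edge `i` consists of the two darts `(i, false)` and `(i, true)`, which leave its two ends
`src (i, false)` and `src (i, true)`. The permutation `rot` sends a dart to the next dart
counterclockwise around the same vertex. -/
structure EmbeddedGraph (k : ℕ) where
  Vert : Type
  [fintypeVert : Fintype Vert]
  src : Fin k × Bool → Vert
  rot : Equiv.Perm (Fin k × Bool)
  src_eq_iff : ∀ a b, src a = src b ↔ rot.SameCycle a b

namespace EmbeddedGraph

attribute [instance] EmbeddedGraph.fintypeVert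

variable {k : ℕ} (G : EmbeddedGraph k)

/-- Adjacency in the spanning subgraph with edge set `F` (forgetting loops and multiplicities). -/
def subgraph (F : Finset (Fin k)) : SimpleGraph G.Vert :=
  SimpleGraph.fromRel fun u v => ∃ i ∈ F, G.src (i, false) = u ∧ G.src (i, true) = v

/-- The graph is nonempty and connected. -/
def Connected : Prop := (G.subgraph Finset.univ).Connected

/-- `F` is the edge set of a spanning tree: the spanning subgraph with edge set `F` is connected
and has one edge less than vertices. -/
def IsSpanningTree (F : Finset (Fin k)) : Prop :=
  (G.subgraph F).Connected ∧ F.card + 1 = Fintype.card G.Vert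

/-- The vertices without edges. -/
abbrev Isolated : Type := {v : G.Vert // ∀ a, G.src a ≠ v}

/-- The number of faces of the embedding (each component being drawn on a surface of its own): the
face on the left of the dart `a = (i, e)` is also on the left of the dart `b` for which `rot b`
is the opposite dart `(i, !e)`; and an isolated vertex lies in a face without darts. -/
def numFaces : ℕ :=
  Nat.card (Quot fun a b : Fin k × Bool => G.rot b = (a.1, !a.2)) + Nat.card G.Isolated

/-- The rotation system is that of an embedding into the plane (Euler's formula). -/
def IsPlane : Prop :=
  Fintype.card G.Vert + G.numFaces =
    k + 2 * Nat.card (G.subgraph Finset.univ).ConnectedComponent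

open Classical in
/-- For a set `F` of edges, the number of sheaves in `F` plus the number of chains not in `F`. -/
def treeWeight (color : Fin k → TwistColor) (F : Finset (Fin k)) : ℕ :=
  (Finset.univ.filter fun i => i ∈ F ∧ color i = .sheaf).card +
    (Finset.univ.filter fun i => i ∉ F ∧ color i = .chain).card

open Classical in
/-- The number `p`: the maximum of `treeWeight` over all spanning trees. -/
def maxTreeWeight (color : Fin k → TwistColor) : ℕ :=
  (Finset.univ.filter G.IsSpanningTree).sup (treeWeight color)

/-! ### The diagrams `D_t`

Draw the edge `i` from its end `(i, false)` in the west to its end `(i, true)` in the east. The edge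
is a twist site with four outer corners `(isEast, isSouth)`, and the shaded regions (the vertices)
lie in the west and in the east of it. Around a vertex, neighbouring sites are joined by an arc
that follows the boundary of the shaded region: from the left side of a dart to
the right side of the next dart counterclockwise.

A site of color `chain` becomes a row of `|t i|` crossings, from west to east (a path of `|t i|`
edges in the signed graph), a site of color `sheaf` a column of `|t i|` crossings, from north to
south (`|t i|` parallel edges). The twist region has two rails (`r = false, true`): the north and
the south one for a chain, the west and the east one for a sheaf. Each rail carries joints at the
levels `0, …, |t i|`, and the `j`-th crossing sits between the levels `j` and `j + 1`. For `t i = 0`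
the two rails are just two parallel arcs. -/

/-- The outer corner at the other end of the arc that leaves the site `i` at the outer corner
`(isEast, isSouth)`; the argument is `((i, isEast), isSouth)`. The corner is on the left of
the dart `(i, isEast)` if and only if `isSouth = isEast`. -/
def medialArc (c : (Fin k × Bool) × Bool) : (Fin k × Bool) × Bool :=
  if c.2 = c.1.2 then (G.rot c.1, !(G.rot c.1).2) else (G.rot.symm c.1, (G.rot.symm c.1).2)

/-- The positions northeast, northwest, southwest, southeast (in counterclockwise order)
as pairs `(isEast, isSouth)`. -/
def compass : Fin 4 ≃ Bool × Bool where
  toFun := ![(true, false), (false, false), (false, true), (true, true)]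
  invFun
    | (true, false) => 0
    | (false, false) => 1
    | (false, true) => 2
    | (true, true) => 3
  left_inv := by decide
  right_inv := by decide

/-- Translation between `(isEast, isSouth)` and `(end, rail)`, in either direction, where
`end = false` is the side of level `0`. -/
def railing : TwistColor → Bool × Bool ≃ Bool × Bool
  | .chain => Equiv.refl _
  | .sheaf => Equiv.prodComm _ _

/-- The pair `(end, rail)` at which a half-edge of a crossing in a twist region is found.
At a positive crossing the half-edges `0, 1, 2, 3` point northeast, northwest,
southwest, southeast, so that the positive smoothing merges the shaded regions in the west and in
the east; at a negative crossing they point northwest, southwest, southeast, northeast. -/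
def port (c : TwistColor) (n : ℤ) : Fin 4 ≃ Bool × Bool :=
  ((Equiv.addRight (if 0 ≤ n then (0 : Fin 4) else 1)).trans compass).trans (railing c)

/-- The crossings of `D_t`: the site `i` carries `|t i|` of them. -/
abbrev TwistCrossing (t : Fin k → ℤ) : Type := Σ i : Fin k, Fin (t i).natAbs

/-- The joints of `D_t`: `(i, level, rail)`, and one for the circle around each isolated vertex. -/
abbrev TwistJoint (t : Fin k → ℤ) : Type :=
  (Σ i : Fin k, Fin ((t i).natAbs + 1) × Bool) ⊕ G.Isolated

variable (color : Fin k → TwistColor) (t : Fin k → ℤ)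

/-- The outermost half-edge at the pair `q = (end, rail)` of the site `i`. -/
def outer (i : Fin k) (q : Bool × Bool) :
    TwistCrossing t × Fin 4 ⊕ G.TwistJoint t × Bool :=
  .inr (.inl ⟨i, (if q.1 then Fin.last _ else 0, q.2)⟩, q.1)

/-- The outermost half-edge to which the one at the pair `q = (end, rail)` of the site `i`
is glued. -/
def outerGlue (i : Fin k) (q : Bool × Bool) :
    TwistCrossing t × Fin 4 ⊕ G.TwistJoint t × Bool :=
  let c := G.medialArc ((i, (railing (color i) q).1), (railing (color i) q).2)
  G.outer t c.1.1 (railing (color c.1.1) (c.1.2, c.2))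

/-- The gluing of the half-edges of `D_t`. -/
def diagramGlue :
    (TwistCrossing t × Fin 4 ⊕ G.TwistJoint t × Bool) →
      (TwistCrossing t × Fin 4 ⊕ G.TwistJoint t × Bool)
  | .inl (⟨i, j⟩, a) =>
      let q := port (color i) (t i) a
      .inr (.inl ⟨i, (if q.1 then j.succ else j.castSucc, q.2)⟩, !q.1)
  | .inr (.inl ⟨i, (l, r)⟩, true) =>
      if h : l.val < (t i).natAbs then
        .inl (⟨i, ⟨l.val, h⟩⟩, (port (color i) (t i)).symm (false, r))
      else G.outerGlue color t i (true, r)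
  | .inr (.inl ⟨i, (l, r)⟩, false) =>
      if h : l = 0 then G.outerGlue color t i (false, r)
      else .inl (⟨i, l.pred h⟩, (port (color i) (t i)).symm (true, r))
  | .inr (.inr v, b) => .inr (.inr v, !b)

theorem medialArc_medialArc (c : (Fin k × Bool) × Bool) : G.medialArc (G.medialArc c) = c := by
  obtain ⟨⟨i, e⟩, s⟩ := c
  by_cases h : s = e
  · simp [medialArc, h]
  · have : s = !e := by revert h; revert s e; decide
    simp [medialArc, this]

theorem medialArc_ne (c : (Fin k × Bool) × Bool) : G.medialArc c ≠ c := by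
  obtain ⟨⟨i, e⟩, s⟩ := c
  intro H
  by_cases h : s = e
  · simp only [medialArc, h, if_true, Prod.mk.injEq] at H
    rw [H.1] at H
    simp at H
  · simp only [medialArc, h, if_false, Prod.mk.injEq] at H
    rw [H.1] at H
    exact h H.2.symm

theorem railing_railing (c : TwistColor) (q : Bool × Bool) : railing c (railing c q) = q := by
  cases c <;> rfl

theorem diagramGlue_outer (i : Fin k) (q : Bool × Bool) :
    G.diagramGlue color t (G.outer t i q) = G.outerGlue color t i q := by
  obtain ⟨_ | _, r⟩ := q <;> simp [outer, diagramGlue]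

theorem diagramGlue_outerGlue (i : Fin k) (q : Bool × Bool) :
    G.diagramGlue color t (G.outerGlue color t i q) = G.outer t i q := by
  unfold outerGlue
  simp only [diagramGlue_outer]
  simp only [outerGlue, railing_railing, Prod.mk.eta, medialArc_medialArc]

theorem outerGlue_ne (i : Fin k) (q : Bool × Bool) :
    G.outerGlue color t i q ≠ G.outer t i q := by
  intro H
  apply G.medialArc_ne ((i, (railing (color i) q).1), (railing (color i) q).2)
  generalize hc : G.medialArc ((i, (railing (color i) q).1), (railing (color i) q).2) = c
  simp only [outerGlue, hc] at H
  obtain ⟨⟨i', e⟩, s⟩ := c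
  have h1 : i' = i := by
    simp only [outer, Sum.inr.injEq, Prod.mk.injEq, Sum.inl.injEq] at H
    exact congrArg Sigma.fst H.1
  subst h1
  have h2 : railing (color i') (e, s) = q := by
    simp only [outer, Sum.inr.injEq, Prod.mk.injEq, Sum.inl.injEq, Sigma.mk.injEq, heq_eq_eq,
      true_and] at H
    exact Prod.ext H.2 H.1.2
  rw [← h2, railing_railing]

theorem diagramGlue_diagramGlue (h : TwistCrossing t × Fin 4 ⊕ G.TwistJoint t × Bool) :
    G.diagramGlue color t (G.diagramGlue color t h) = h := by
  rcases h with ⟨⟨i, j⟩, a⟩ | ⟨⟨i, l, r⟩ | v, _ | _⟩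
  · rcases hq : port (color i) (t i) a with ⟨_ | _, r⟩ <;>
      simp [diagramGlue, hq, Equiv.symm_apply_eq]
  · by_cases h : l = 0
    · subst h
      exact G.diagramGlue_outerGlue color t i (false, r)
    · simp [diagramGlue, h]
  · by_cases h : l.val < (t i).natAbs
    · simp [diagramGlue, h]
    · have : l = Fin.last _ := Fin.ext (by have := l.isLt; simp only [Fin.val_last]; omega)
      subst this
      have := G.diagramGlue_outerGlue color t i (true, r)
      simpa [diagramGlue, outer] using this
  · simp [diagramGlue]
  · simp [diagramGlue]

theorem diagramGlue_ne (h : TwistCrossing t × Fin 4 ⊕ G.TwistJoint t × Bool) :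
    G.diagramGlue color t h ≠ h := by
  rcases h with ⟨⟨i, j⟩, a⟩ | ⟨⟨i, l, r⟩ | v, _ | _⟩
  · simp [diagramGlue]
  · by_cases h : l = 0
    · subst h
      exact G.outerGlue_ne color t i (false, r)
    · simp [diagramGlue, h]
  · by_cases h : l.val < (t i).natAbs
    · simp [diagramGlue, h]
    · have : l = Fin.last _ := Fin.ext (by have := l.isLt; simp only [Fin.val_last]; omega)
      subst this
      have := G.outerGlue_ne color t i (true, r)
      simpa [diagramGlue, outer] using this
  · simp [diagramGlue]
  · simp [diagramGlue]

/-- The link diagram `D_t`. -/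
def diagram : LinkDiagram where
  Crossing := TwistCrossing t
  Joint := G.TwistJoint t
  fintypeJoint := by classical exact inferInstance
  glue := G.diagramGlue color t
  glue_glue := G.diagramGlue_diagramGlue color t
  glue_ne := G.diagramGlue_ne color t

end EmbeddedGraph

/-! ### Mahler measure and `L²` norm of Laurent polynomials in one variable -/

namespace LaurentPolynomial

/-- The value `f (e ^ (2 π i θ))`. -/
def circleEval (f : ℂ[T;T⁻¹]) (θ : ℝ) : ℂ :=
  LaurentPolynomial.eval₂ (RingHom.id ℂ) (Circle.toUnits (Circle.exp (2 * Real.pi * θ))) f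

open Classical in
/-- The Mahler measure `exp ∫₀¹ log |f (e ^ (2 π i θ))| dθ`, with the value `0` at `f = 0`. -/
def mahlerMeasure (f : ℂ[T;T⁻¹]) : ℝ :=
  if f = 0 then 0 else Real.exp (∫ θ in (0 : ℝ)..1, Real.log ‖circleEval f θ‖)

/-- The `L²` norm on the unit circle. -/
def l2Norm (f : ℂ[T;T⁻¹]) : ℝ :=
  Real.sqrt (∫ θ in (0 : ℝ)..1, ‖circleEval f θ‖ ^ 2)

end LaurentPolynomial

end

/-!
A crossing of `D_t` has one smoothing that leaves the two rails of its twist site parallel and one that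
cuts them. In a state of `D_t`, every site is either uncut, or cut by `m ≥ 1` crossings; in the latter
case it looks like a single cut with `m - 1` additional circles between consecutive cuts. Which sites
are cut determines a set `M` of merged edges of `G` (the chains that are not cut and the sheaves that
are), and the remaining curves of the state are the boundary components of the ribbon graph with edge
set `M` (`EmbeddedGraph.loops_railState`). Summing over all states with the same cut sites, one finds
for an uncut site with `n` crossings the factor `A ^ (±n)`, and for a cut one the factor
`((-A ^ (∓3)) ^ n - A ^ (±n)) / d`, because `A + A⁻¹ d = -A⁻³`. So `⟨D_t⟩` is a sum over the subsets `M`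
of the edges, with terms that are bounded on the unit circle independently of `t`, except for one
denominator `d` for each cut site (`EmbeddedGraph.bracket_diagram`).

The number of cut sites is the weight of `M`, counted as for spanning trees. If `M` has `b` boundary
components, the term of `M` carries the factor `d ^ (b - 1)`, and it remains to see that the weight of
`M` is at most `p + (b - 1)`
(`EmbeddedGraph.treeWeight_add_one_le_maxTreeWeight_add_numBoundary`). Adding an edge to `M` multiplies
a permutation whose cycles are the boundary components by a transposition; hence `b` rises by at most
one, and drops by one if the edge joins two components of `M`. This reduces the claim to connected `M`,
in which case `M` is a spanning tree with `|M| - V + 1` further edges, and Euler's formula for `G` gives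
`b ≥ |M| - V + 2`. Hence `d ^ p ⟨D_t⟩` is bounded on the unit circle independently of `t`, and so is its
`L²` norm.

The Mahler measure is multiplicative, and that of `d` is `1` since `d` is cyclotomic up to a unit. It is
bounded by the `L²` norm by Jensen's inequality for the exponential function and `log |f|²`, with
equality only if `|f|` is constant on the circle (`LaurentPolynomial.mahlerMeasure_lt_l2Norm_or`). If
`p ≥ 1`, this is excluded by the zeros of `d`, provided that `⟨D_t⟩ ≠ 0`; and `⟨D⟩` takes the value `1` at
`A = e ^ (π i / 3)` for every diagram `D` (`LinkDiagram.bracket_ne_zero`), because `d` and `A + A⁻¹` are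
both `1` there.
-/

noncomputable section

/-! ### Mahler measure and `L²` norm -/

namespace LaurentPolynomial

open MeasureTheory

theorem circleEval_mul (f g : ℂ[T;T⁻¹]) (θ : ℝ) :
    circleEval (f * g) θ = circleEval f θ * circleEval g θ := map_mul _ f g

theorem circleEval_T (n : ℤ) (θ : ℝ) :
    circleEval (T n) θ = ((Circle.exp (2 * Real.pi * θ) ^ n : Circle) : ℂ) := by
  simp only [circleEval, eval₂_T, ← map_zpow]
  rfl

theorem norm_circleEval_T (n : ℤ) (θ : ℝ) : ‖circleEval (T n) θ‖ = 1 := by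
  rw [circleEval_T, Circle.norm_coe]

/-- On the unit circle, a Laurent polynomial has the same absolute value as the polynomial obtained
from it by clearing denominators. -/
theorem norm_circleEval_eq {f : ℂ[T;T⁻¹]} {q : Polynomial ℂ} {n : ℤ}
    (h : Polynomial.toLaurent q = f * T n) (θ : ℝ) :
    ‖circleEval f θ‖ = ‖q.eval (circleMap 0 1 (2 * Real.pi * θ))‖ := by
  have h1 : circleEval (Polynomial.toLaurent q) θ = q.eval (circleMap 0 1 (2 * Real.pi * θ)) := by
    simp only [circleEval, eval₂_toLaurent, Polynomial.eval₂_id]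
    congr 1
    rw [circleMap, zero_add, Complex.ofReal_one, one_mul, ← Circle.coe_exp]
    rfl
  rw [← h1, h, circleEval_mul, norm_mul, norm_circleEval_T, mul_one]

theorem mahlerMeasure_eq {f : ℂ[T;T⁻¹]} {q : Polynomial ℂ} {n : ℤ}
    (h : Polynomial.toLaurent q = f * T n) : f.mahlerMeasure = q.mahlerMeasure := by
  by_cases hf : f = 0
  · have : q = 0 := by
      rw [hf, zero_mul] at h
      exact Polynomial.toLaurent_injective (by rw [h, map_zero])
    simp [mahlerMeasure, hf, this]
  have hq : q ≠ 0 := by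
    rintro rfl
    rw [map_zero] at h
    exact hf ((mul_eq_zero.1 h.symm).resolve_right (isUnit_T n).ne_zero)
  rw [mahlerMeasure, if_neg hf, Polynomial.mahlerMeasure_def_of_ne_zero hq]
  simp only [norm_circleEval_eq h]
  rw [intervalIntegral.integral_comp_mul_left
    (fun x => Real.log ‖q.eval (circleMap 0 1 x)‖) (by positivity)]
  simp

theorem mahlerMeasure_mul (f g : ℂ[T;T⁻¹]) :
    (f * g).mahlerMeasure = f.mahlerMeasure * g.mahlerMeasure := by
  obtain ⟨n, p, hp⟩ := f.exists_T_pow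
  obtain ⟨m, q, hq⟩ := g.exists_T_pow
  have h : Polynomial.toLaurent (p * q) = f * g * T (n + m : ℤ) := by
    rw [map_mul, hp, hq, T_add]; ring
  rw [mahlerMeasure_eq hp, mahlerMeasure_eq hq, mahlerMeasure_eq h, Polynomial.mahlerMeasure_mul]

theorem mahlerMeasure_pow (f : ℂ[T;T⁻¹]) (n : ℕ) :
    (f ^ n).mahlerMeasure = f.mahlerMeasure ^ n := by
  induction n with
  | zero =>
    rw [pow_zero, pow_zero, mahlerMeasure_eq (q := 1) (n := 0) (by simp),
      Polynomial.mahlerMeasure_one]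
  | succ n ih => rw [pow_succ, pow_succ, mahlerMeasure_mul, ih]

theorem continuous_norm_circleEval (f : ℂ[T;T⁻¹]) : Continuous fun θ => ‖circleEval f θ‖ := by
  obtain ⟨n, q, hq⟩ := f.exists_T_pow
  simp only [norm_circleEval_eq hq]
  have := continuous_circleMap 0 1
  fun_prop

/-- A nonzero Laurent polynomial has only countably many zeros on the circle. -/
theorem ae_circleEval_ne_zero {f : ℂ[T;T⁻¹]} (hf : f ≠ 0) :
    ∀ᵐ θ : ℝ, circleEval f θ ≠ 0 := by
  obtain ⟨n, q, hq⟩ := f.exists_T_pow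
  have hq0 : q ≠ 0 := by
    rintro rfl
    rw [map_zero] at hq
    exact hf ((mul_eq_zero.1 hq.symm).resolve_right (isUnit_T n).ne_zero)
  have h1 : (circleMap 0 1 ⁻¹' {z | q.IsRoot z}).Countable :=
    (Polynomial.finite_setOfPred_isRoot hq0).countable.preimage_circleMap 0 one_ne_zero
  have h2 : ((fun θ : ℝ => 2 * Real.pi * θ) ⁻¹' (circleMap 0 1 ⁻¹' {z | q.IsRoot z})).Countable :=
    h1.preimage (mul_right_injective₀ (by positivity))
  filter_upwards [h2.ae_notMem volume] with θ hθ h0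
  apply hθ
  rw [← norm_eq_zero, norm_circleEval_eq hq, norm_eq_zero] at h0
  exact h0

theorem intervalIntegrable_log_norm_circleEval (f : ℂ[T;T⁻¹]) :
    IntervalIntegrable (fun θ => Real.log ‖circleEval f θ‖) volume 0 1 := by
  obtain ⟨n, q, hq⟩ := f.exists_T_pow
  simp only [norm_circleEval_eq hq]
  have := q.intervalIntegrable_mahlerMeasure.comp_mul_left (c := 2 * Real.pi)
  simpa [Real.pi_ne_zero] using this

/-- Jensen's inequality for `exp` and `log |f|²`: the Mahler measure is at most the `L²` norm, and it
is smaller unless `|f|` is constant on the circle. -/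
theorem mahlerMeasure_lt_l2Norm_or {f : ℂ[T;T⁻¹]} (hf : f ≠ 0) :
    f.mahlerMeasure < f.l2Norm ∨
      f.mahlerMeasure = f.l2Norm ∧ ∀ θ ∈ Set.Icc (0 : ℝ) 1, circleEval f θ ≠ 0 := by
  set μ : Measure ℝ := volume.restrict (Set.Ioc 0 1) with hμ
  have : IsProbabilityMeasure μ := ⟨by simp [hμ]⟩
  set u : ℝ → ℝ := fun θ => 2 * Real.log ‖circleEval f θ‖ with hu
  have hexp : ∀ᵐ θ ∂μ, Real.exp (u θ) = ‖circleEval f θ‖ ^ 2 := by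
    filter_upwards [ae_restrict_of_ae (ae_circleEval_ne_zero hf)] with θ hθ
    simp only [hu]
    rw [two_mul, Real.exp_add, Real.exp_log (norm_pos_iff.2 hθ), sq]
  have hui : Integrable u μ :=
    ((intervalIntegrable_iff_integrableOn_Ioc_of_le zero_le_one).1
      (intervalIntegrable_log_norm_circleEval f)).const_mul 2
  have hsq : Continuous fun θ => ‖circleEval f θ‖ ^ 2 := (continuous_norm_circleEval f).pow 2
  have hsqi : Integrable (fun θ => ‖circleEval f θ‖ ^ 2) μ :=
    (intervalIntegrable_iff_integrableOn_Ioc_of_le zero_le_one).1 (hsq.intervalIntegrable 0 1)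
  have hM : f.mahlerMeasure ^ 2 = Real.exp (∫ θ, u θ ∂μ) := by
    rw [mahlerMeasure, if_neg hf, ← Real.exp_nat_mul, intervalIntegral.integral_of_le zero_le_one,
      integral_const_mul]
    simp [hμ]
  have hM0 : 0 ≤ f.mahlerMeasure := by
    rw [mahlerMeasure, if_neg hf]; exact (Real.exp_pos _).le
  have hL : f.l2Norm = Real.sqrt (∫ θ, ‖circleEval f θ‖ ^ 2 ∂μ) := by
    rw [l2Norm, intervalIntegral.integral_of_le zero_le_one]
  have hMs : f.mahlerMeasure = Real.sqrt (Real.exp (∫ θ, u θ ∂μ)) := by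
    rw [← hM, Real.sqrt_sq hM0]
  have hgi : Integrable (Real.exp ∘ u) μ := hsqi.congr (hexp.mono fun θ h => h.symm)
  rcases strictConvexOn_exp.ae_eq_const_or_map_average_lt Real.continuous_exp.continuousOn
    isClosed_univ (Filter.Eventually.of_forall fun _ => Set.mem_univ _) hui hgi with h | h
  · right
    rw [average_eq_integral] at h
    set c := ∫ θ, u θ ∂μ
    have h1 : ∀ᵐ θ ∂μ, ‖circleEval f θ‖ ^ 2 = Real.exp c := by
      filter_upwards [h, hexp] with θ h1 h2
      rw [← h2, h1, Function.const_apply]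
    refine ⟨?_, ?_⟩
    · rw [hMs, hL, integral_congr_ae h1]
      simp
    · -- two continuous functions which agree almost everywhere on `(0, 1)` agree on `[0, 1]`
      have h2 : ∀ᵐ θ ∂(volume.restrict (Set.Icc (0 : ℝ) 1)),
          ‖circleEval f θ‖ ^ 2 = Real.exp c := by
        rwa [hμ, restrict_Ioc_eq_restrict_Icc] at h1
      have h3 := MeasureTheory.Measure.eqOn_Icc_of_ae_eq volume (zero_ne_one (α := ℝ)) h2
        hsq.continuousOn continuousOn_const
      intro θ hθ h0
      have := h3 hθ
      simp only [h0] at this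
      simp at this
      exact (Real.exp_pos c).ne this
  · left
    rw [average_eq_integral, average_eq_integral, integral_congr_ae hexp] at h
    rw [hMs, hL]
    exact Real.sqrt_lt_sqrt (Real.exp_pos _).le h

/-- The `L²` norm is at most the supremum norm on the circle. -/
theorem l2Norm_le {f : ℂ[T;T⁻¹]} {B : ℝ} (hB : 0 ≤ B) (h : ∀ θ, ‖circleEval f θ‖ ≤ B) :
    f.l2Norm ≤ B := by
  rw [l2Norm]
  apply Real.sqrt_le_iff.2 ⟨hB, ?_⟩
  have hsq : Continuous fun θ => ‖circleEval f θ‖ ^ 2 := (continuous_norm_circleEval f).pow 2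
  calc ∫ θ in (0 : ℝ)..1, ‖circleEval f θ‖ ^ 2 ≤ ∫ θ in (0 : ℝ)..1, B ^ 2 :=
        intervalIntegral.integral_mono_on zero_le_one (hsq.intervalIntegrable 0 1)
          (by simp) fun θ _ => pow_le_pow_left₀ (norm_nonneg _) (h θ) 2
    _ = B ^ 2 := by simp

end LaurentPolynomial

/-! ### The polynomial `d`, and the nonvanishing of the bracket -/

open LaurentPolynomial

theorem T_two_mul_kauffmanD :
    T 2 * kauffmanD = -Polynomial.toLaurent (Polynomial.cyclotomic 8 ℂ) := by
  have h8 : Polynomial.cyclotomic 8 ℂ = Polynomial.X ^ 4 + 1 := by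
    have : (8 : ℕ) = 2 ^ (2 + 1) := by norm_num
    rw [this, Polynomial.cyclotomic_prime_pow_eq_geom_sum Nat.prime_two]
    simp [Finset.sum_range_succ]
    ring
  rw [h8, kauffmanD, mul_sub, mul_neg, ← T_add, ← T_add]
  simp
  ring

theorem mahlerMeasure_kauffmanD : kauffmanD.mahlerMeasure = 1 := by
  have h : Polynomial.toLaurent (Polynomial.C (-1) * Polynomial.cyclotomic 8 ℂ) =
      kauffmanD * T 2 := by
    rw [mul_comm kauffmanD, T_two_mul_kauffmanD]
    simp
  rw [mahlerMeasure_eq h, Polynomial.mahlerMeasure_mul, Polynomial.mahlerMeasure_const]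
  have := Polynomial.cyclotomic_mahlerMeasure_eq_one (R := ℂ) 8
  simp at this
  simp [this]

theorem kauffmanD_ne_zero : kauffmanD ≠ 0 := by
  intro h
  have := mahlerMeasure_kauffmanD
  simp [h, mahlerMeasure] at this

theorem norm_circleEval_kauffmanD_le (θ : ℝ) : ‖circleEval kauffmanD θ‖ ≤ 2 := by
  have : circleEval kauffmanD θ = -circleEval (T (-2)) θ - circleEval (T 2) θ := by
    simp [kauffmanD, circleEval]
  rw [this]
  refine (norm_sub_le _ _).trans ?_
  rw [norm_neg, norm_circleEval_T, norm_circleEval_T]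
  norm_num

/-- The primitive eighth root of unity `e ^ (2 π i / 8)` is a zero of `d`. -/
theorem circleEval_kauffmanD_eighth : circleEval kauffmanD (1 / 8) = 0 := by
  have h : circleEval (T 2) (1 / 8) = Complex.I := by
    rw [circleEval_T, Circle.coe_zpow, Circle.coe_exp, ← Complex.exp_int_mul]
    rw [show ((2 : ℤ) : ℂ) * (((2 * Real.pi * (1 / 8) : ℝ) : ℂ) * Complex.I) =
      Real.pi / 2 * Complex.I by push_cast; ring]
    exact Complex.exp_pi_div_two_mul_I
  have h' : circleEval (T (-2)) (1 / 8) = -Complex.I := by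
    rw [circleEval_T, Circle.coe_zpow, zpow_neg, ← Circle.coe_zpow, ← circleEval_T, h,
      Complex.inv_I]
  have : circleEval kauffmanD (1 / 8) =
      -circleEval (T (-2)) (1 / 8) - circleEval (T 2) (1 / 8) := by
    simp [kauffmanD, circleEval]
  rw [this, h, h']
  ring

/-- At `A = e ^ (2 π i / 6)` both `d` and `A + A⁻¹` are `1`, so that the state sum collapses to
`∏ (A + A⁻¹) = 1`. -/
theorem LinkDiagram.bracket_ne_zero (D : LinkDiagram) : D.bracket ≠ 0 := by
  classical
  intro h
  have hsum : circleEval (T 1) (1 / 6) + circleEval (T (-1)) (1 / 6) = 1 := by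
    have h3 : ((Real.pi / 3 : ℝ) : ℂ) = Real.pi / 3 := by push_cast; ring
    have h2 : circleEval (T 1) (1 / 6) = Complex.exp ((Real.pi / 3 : ℝ) * Complex.I) := by
      rw [circleEval_T, zpow_one, Circle.coe_exp]
      congr 2; push_cast; ring
    have h2' : circleEval (T (-1)) (1 / 6) = Complex.exp (-(Real.pi / 3 : ℝ) * Complex.I) := by
      rw [circleEval_T, zpow_neg, zpow_one, Circle.coe_inv, Circle.coe_exp, ← Complex.exp_neg]
      congr 1; push_cast; ring
    rw [h2, h2', ← Complex.two_cos, ← Complex.ofReal_cos, Real.cos_pi_div_three]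
    norm_num
  have hd : circleEval kauffmanD (1 / 6) = 1 := by
    have e1 : kauffmanD = 2 - (T 1 + T (-1)) ^ 2 := by
      have h1 : (T 1 : ℂ[T;T⁻¹]) * T (-1) = 1 := by rw [← T_add]; simp
      have h2 : (T 2 : ℂ[T;T⁻¹]) = T 1 * T 1 := by rw [← T_add]; norm_num
      have h3 : (T (-2) : ℂ[T;T⁻¹]) = T (-1) * T (-1) := by rw [← T_add]; norm_num
      rw [kauffmanD, h2, h3]
      linear_combination (2 : ℂ[T;T⁻¹]) * h1
    have e2 : circleEval kauffmanD (1 / 6) =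
        2 - (circleEval (T 1) (1 / 6) + circleEval (T (-1)) (1 / 6)) ^ 2 := by
      rw [e1]
      unfold circleEval
      rw [map_sub, map_pow, map_add, map_ofNat]
    rw [e2, hsum]; norm_num
  have key : circleEval D.bracket (1 / 6) =
      ∑ s : D.Crossing → Bool, ∏ x, circleEval (T (if s x then 1 else -1)) (1 / 6) := by
    have hd' := hd
    unfold circleEval at hd' ⊢
    unfold LinkDiagram.bracket
    rw [map_sum]
    refine Finset.sum_congr (by congr!) fun s _ => ?_
    rw [map_mul, map_pow, hd', one_pow, mul_one, map_prod]
  have h1 : circleEval D.bracket (1 / 6) = 1 := by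
    rw [key, ← Fintype.prod_sum fun (_ : D.Crossing) (b : Bool) =>
      circleEval (T (if b then 1 else -1)) (1 / 6)]
    simp only [Fintype.sum_bool, if_true, Bool.false_eq_true, if_false, hsum, Finset.prod_const_one]
  rw [h] at h1
  simp [circleEval] at h1

/-! ### Finite quotients and cycles of permutations -/

section Quotients

variable {α : Type*} [Finite α] (r : α → α → Prop) (a b : α)

theorem Nat.card_quot_or_le :
    Nat.card (Quot fun x y => r x y ∨ (x = a ∧ y = b)) ≤ Nat.card (Quot r) :=
  Nat.card_le_card_of_surjective (Quot.map id fun _ _ h => .inl h) fun q => by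
    induction q using Quot.ind with
    | mk x => exact ⟨Quot.mk _ x, rfl⟩

/-- Identifying two points of a finite quotient removes at most one class. -/
theorem Nat.card_quot_le_or_add_one :
    Nat.card (Quot r) ≤ Nat.card (Quot fun x y => r x y ∨ (x = a ∧ y = b)) + 1 := by
  classical
  set r' := fun x y => r x y ∨ (x = a ∧ y = b)
  -- the coarser quotient determines a class up to replacing the class of `a` by that of `b`
  let g : Quot r' → Quot r := Quot.lift
    (fun x => if Quot.mk r x = Quot.mk r a then Quot.mk r b else Quot.mk r x) (by
      rintro x y (h | ⟨rfl, rfl⟩)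
      · simp only [Quot.sound h]
      · simp)
  let π : Quot r → Quot r' := Quot.map id fun _ _ h => .inl h
  have hg : ∀ q, g (π q) = if q = Quot.mk r a then Quot.mk r b else q := by
    rintro ⟨x⟩; rfl
  have hinj : Function.Injective fun q : Quot r =>
      if q = Quot.mk r a then none else some (π q) := by
    intro p q hpq
    simp only at hpq
    split_ifs at hpq with h1 h2 h2
    · rw [h1, h2]
    · have := congrArg g (Option.some.inj hpq)
      rwa [hg, hg, if_neg h1, if_neg h2] at this
  have := Nat.card_le_card_of_injective _ hinj
  rwa [Finite.card_option] at this

theorem Nat.card_quot_or_of_eq (h : Quot.mk r a = Quot.mk r b) :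
    Nat.card (Quot fun x y => r x y ∨ (x = a ∧ y = b)) = Nat.card (Quot r) := by
  refine le_antisymm (Nat.card_quot_or_le r a b) (Nat.card_le_card_of_surjective
    (Quot.lift (Quot.mk r) ?_) ?_)
  · rintro x y (h' | ⟨rfl, rfl⟩)
    exacts [Quot.sound h', h]
  · rintro ⟨x⟩
    exact ⟨Quot.mk _ x, rfl⟩

theorem Nat.card_quot_or_add_one_le (h : Quot.mk r a ≠ Quot.mk r b) :
    Nat.card (Quot fun x y => r x y ∨ (x = a ∧ y = b)) + 1 ≤ Nat.card (Quot r) := by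
  refine Nat.lt_of_le_of_ne (Nat.card_quot_or_le r a b) fun hc => h ?_
  let π : Quot r → Quot fun x y => r x y ∨ (x = a ∧ y = b) := Quot.map id fun _ _ h => .inl h
  have hs : Function.Surjective π := fun q => by
    induction q using Quot.ind with
    | mk x => exact ⟨Quot.mk _ x, rfl⟩
  have hb : Function.Bijective π := by
    rw [Nat.bijective_iff_surjective_and_card]
    exact ⟨hs, hc.symm⟩
  exact hb.1 (Quot.sound (.inr ⟨rfl, rfl⟩))

end Quotients

namespace Equiv.Perm

variable {α : Type*} (π : Perm α)

/-- The set of cycles of a permutation, fixed points included. -/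
abbrev Orbits : Type _ := Quot fun x y => y = π x

theorem mk_eq_mk_of_sameCycle [Finite α] {a b : α} (h : π.SameCycle a b) :
    (Quot.mk _ a : π.Orbits) = Quot.mk _ b := by
  obtain ⟨n, rfl⟩ := h.exists_nat_pow_eq
  induction n with
  | zero => rfl
  | succ n ih =>
    rw [ih ⟨n, rfl⟩, pow_succ', mul_apply]
    exact Quot.sound rfl

variable [DecidableEq α]

/-- Multiplication by a transposition merges two different cycles. -/
theorem sameCycle_mul_swap [Finite α] {a b : α} (h : ¬ π.SameCycle a b) :
    (π * swap a b).SameCycle a b := by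
  by_contra h'
  have key : ∀ n : ℕ, ((π * swap a b) ^ (n + 1)) a = (π ^ (n + 1)) b := by
    intro n
    induction n with
    | zero => simp
    | succ n ih =>
      rw [pow_succ', mul_apply, ih, pow_succ' π (n + 1), mul_apply, mul_apply, swap_apply_of_ne_of_ne]
      · intro h1
        exact h (SameCycle.symm ⟨(n + 1 : ℕ), h1⟩)
      · intro h1
        exact h' ⟨(n + 1 : ℕ), by rw [zpow_natCast, ih, h1]⟩
  have hn := key (orderOf π - 1)
  rw [Nat.sub_add_cancel (orderOf_pos π), pow_orderOf_eq_one] at hn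
  exact h' ⟨orderOf π, by rw [zpow_natCast, hn, one_apply]⟩

variable [Finite α] (a b : α)

theorem card_quot_mul_swap :
    Nat.card (Quot fun x y => y = (π * swap a b) x ∨ (x = a ∧ y = b)) =
      Nat.card (Quot fun x y => y = π x ∨ (x = a ∧ y = b)) := by
  have key : ∀ π : Perm α, Nat.card (Quot fun x y => y = (π * swap a b) x ∨ (x = a ∧ y = b)) ≤
      Nat.card (Quot fun x y => y = π x ∨ (x = a ∧ y = b)) := by
    intro π
    have hab : Quot.mk (fun x y => y = (π * swap a b) x ∨ (x = a ∧ y = b)) a = Quot.mk _ b :=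
      Quot.sound (.inr ⟨rfl, rfl⟩)
    refine Nat.card_le_card_of_surjective (Quot.lift (Quot.mk _) ?_)
      (by rintro ⟨x⟩; exact ⟨Quot.mk _ x, rfl⟩)
    rintro x y (rfl | ⟨rfl, rfl⟩)
    · by_cases hxa : x = a
      · subst hxa
        exact hab.trans (Quot.sound (.inl (by simp)))
      by_cases hxb : x = b
      · subst hxb
        exact hab.symm.trans (Quot.sound (.inl (by simp)))
      exact Quot.sound (.inl (by rw [mul_apply, swap_apply_of_ne_of_ne hxa hxb]))
    · exact hab
  refine le_antisymm (key π) ?_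
  have := key (π * swap a b)
  rwa [mul_assoc, swap_mul_self, mul_one] at this

theorem card_orbits_le_mul_swap :
    Nat.card π.Orbits ≤ Nat.card (π * swap a b).Orbits + 1 :=
  calc Nat.card π.Orbits ≤ Nat.card (Quot fun x y => y = π x ∨ (x = a ∧ y = b)) + 1 :=
        Nat.card_quot_le_or_add_one _ a b
    _ = Nat.card (Quot fun x y => y = (π * swap a b) x ∨ (x = a ∧ y = b)) + 1 := by
        rw [card_quot_mul_swap]
    _ ≤ _ := Nat.add_le_add_right (Nat.card_quot_or_le _ a b) 1

theorem card_orbits_mul_swap_add_one_le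
    (h : (Quot.mk _ a : π.Orbits) ≠ Quot.mk _ b) :
    Nat.card (π * swap a b).Orbits + 1 ≤ Nat.card π.Orbits := by
  have h1 := Nat.card_quot_or_of_eq _ a b ((π * swap a b).mk_eq_mk_of_sameCycle
    (π.sameCycle_mul_swap fun h' => h (π.mk_eq_mk_of_sameCycle h')))
  rw [card_quot_mul_swap] at h1
  have h2 := Nat.card_quot_or_add_one_le _ a b h
  rw [h1] at h2
  exact h2

end Equiv.Perm

/-! ### Boundary components of ribbon subgraphs, and spanning trees -/

namespace EmbeddedGraph

open Equiv.Perm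

variable {k : ℕ} (G : EmbeddedGraph k)

/-- The involution of the darts which reverses the edges in `M`. -/
def edgeFlip (M : Finset (Fin k)) : Equiv.Perm (Fin k × Bool) :=
  Function.Involutive.toPerm (fun a => (a.1, if a.1 ∈ M then !a.2 else a.2)) (by
    rintro ⟨i, b⟩
    by_cases h : i ∈ M <;> simp [h])

theorem edgeFlip_apply (M : Finset (Fin k)) (a : Fin k × Bool) :
    edgeFlip M a = (a.1, if a.1 ∈ M then !a.2 else a.2) := rfl

/-- The permutation of the darts whose cycles are the boundary components of the ribbon graph with
the edges in `M`: on the left of the dart `a`, the boundary runs along `a` to its other end if the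
edge of `a` belongs to `M`, and across the root of `a` otherwise; in both cases it continues on the
left of `boundaryPerm M a`. -/
def boundaryPerm (M : Finset (Fin k)) : Equiv.Perm (Fin k × Bool) := G.rot⁻¹ * edgeFlip M

theorem eq_boundaryPerm_iff (M : Finset (Fin k)) (a b : Fin k × Bool) :
    b = G.boundaryPerm M a ↔ G.rot b = edgeFlip M a := by
  rw [boundaryPerm, mul_apply, eq_inv_iff_eq]

/-- The number of boundary components of the ribbon graph with edge set `M`, those around the
isolated vertices of `G` included. -/
def numBoundary (M : Finset (Fin k)) : ℕ :=
  Nat.card (G.boundaryPerm M).Orbits + Nat.card G.Isolated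

theorem numBoundary_univ : G.numBoundary Finset.univ = G.numFaces := by
  unfold numBoundary numFaces Orbits
  simp only [eq_boundaryPerm_iff, edgeFlip_apply, Finset.mem_univ, if_true]

theorem boundaryPerm_insert {M : Finset (Fin k)} {i : Fin k} (hi : i ∉ M) :
    G.boundaryPerm (insert i M) = G.boundaryPerm M * Equiv.swap (i, false) (i, true) := by
  rw [boundaryPerm, boundaryPerm, mul_assoc]
  congr 1
  ext1 ⟨j, b⟩
  by_cases hj : j = i
  · subst hj
    cases b <;> simp [edgeFlip_apply, hi]
  · rw [mul_apply, Equiv.swap_apply_of_ne_of_ne (by simp [hj]) (by simp [hj])]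
    simp [edgeFlip_apply, hj]

theorem numBoundary_insert_le (M : Finset (Fin k)) (i : Fin k) :
    G.numBoundary (insert i M) ≤ G.numBoundary M + 1 := by
  by_cases hi : i ∈ M
  · rw [Finset.insert_eq_of_mem hi]; omega
  · have := card_orbits_le_mul_swap (G.boundaryPerm (insert i M)) (i, false) (i, true)
    rw [G.boundaryPerm_insert hi, mul_assoc, Equiv.swap_mul_self, mul_one] at this
    rw [numBoundary, numBoundary, G.boundaryPerm_insert hi]
    omega

theorem numBoundary_union_le (M N : Finset (Fin k)) :
    G.numBoundary (M ∪ N) ≤ G.numBoundary M + N.card := by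
  induction N using Finset.induction_on with
  | empty => simp
  | insert i N hi ih =>
    rw [Finset.union_insert, Finset.card_insert_of_notMem hi]
    have := G.numBoundary_insert_le (M ∪ N) i
    omega

theorem reachable_src {M : Finset (Fin k)} {i : Fin k} (hi : i ∈ M) :
    (G.subgraph M).Reachable (G.src (i, false)) (G.src (i, true)) := by
  by_cases h : G.src (i, false) = G.src (i, true)
  · rw [h]
  · exact SimpleGraph.Adj.reachable
      ((SimpleGraph.fromRel_adj _ _ _).2 ⟨h, .inl ⟨i, hi, rfl, rfl⟩⟩)

/-- A boundary component stays in one component of the subgraph. -/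
theorem reachable_of_mk_eq {M : Finset (Fin k)} {a b : Fin k × Bool}
    (h : (Quot.mk _ a : (G.boundaryPerm M).Orbits) = Quot.mk _ b) :
    (G.subgraph M).Reachable (G.src a) (G.src b) := by
  let f : (G.boundaryPerm M).Orbits → (G.subgraph M).ConnectedComponent :=
    Quot.lift (fun x => (G.subgraph M).connectedComponentMk (G.src x)) (by
      intro x y hxy
      rw [eq_boundaryPerm_iff] at hxy
      rw [SimpleGraph.ConnectedComponent.eq]
      have h1 : G.src y = G.src (G.rot y) :=
        (G.src_eq_iff _ _).2 (sameCycle_apply_right.2 (SameCycle.refl _ _))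
      rw [h1, hxy, edgeFlip_apply]
      obtain ⟨i, e⟩ := x
      by_cases hi : i ∈ M
      · have := G.reachable_src hi
        cases e <;> simp only [hi, if_true, Bool.not_true, Bool.not_false]
        exacts [this, this.symm]
      · simp [hi])
  exact SimpleGraph.ConnectedComponent.exact (congrArg f h)

theorem numBoundary_insert_add_one_le {M : Finset (Fin k)} {i : Fin k}
    (h : ¬ (G.subgraph M).Reachable (G.src (i, false)) (G.src (i, true))) :
    G.numBoundary (insert i M) + 1 ≤ G.numBoundary M := by
  have hi : i ∉ M := fun hi => h (G.reachable_src hi)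
  have := card_orbits_mul_swap_add_one_le (G.boundaryPerm M) (i, false) (i, true)
    fun h' => h (G.reachable_of_mk_eq h')
  rw [numBoundary, numBoundary, G.boundaryPerm_insert hi]
  omega

variable {G}

theorem exists_not_reachable (hG : G.Connected) {M : Finset (Fin k)}
    (hM : ¬ (G.subgraph M).Connected) :
    ∃ i, ¬ (G.subgraph M).Reachable (G.src (i, false)) (G.src (i, true)) := by
  by_contra! h
  apply hM
  have : Nonempty G.Vert := hG.nonempty
  refine ⟨fun u v => ?_⟩
  obtain ⟨w⟩ := hG.preconnected u v
  induction w with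
  | nil => exact SimpleGraph.Reachable.refl _
  | cons huv _ ih =>
    refine SimpleGraph.Reachable.trans ?_ ih
    obtain ⟨-, ⟨i, -, rfl, rfl⟩ | ⟨i, -, rfl, rfl⟩⟩ := (SimpleGraph.fromRel_adj _ _ _).1 huv
    exacts [h i, (h i).symm]

theorem exists_isSpanningTree_subset {M : Finset (Fin k)} (hM : (G.subgraph M).Connected) :
    ∃ F ⊆ M, G.IsSpanningTree F := by
  classical
  obtain ⟨T, hT, hTree⟩ := hM.exists_isTree_le
  have hex : ∀ e : T.edgeSet, ∃ i ∈ M, s(G.src (i, false), G.src (i, true)) = e.1 := by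
    rintro ⟨⟨u, v⟩, he⟩
    have huv : (G.subgraph M).Adj u v := hT he
    obtain ⟨-, ⟨i, hi, rfl, rfl⟩ | ⟨i, hi, rfl, rfl⟩⟩ := (SimpleGraph.fromRel_adj _ _ _).1 huv
    exacts [⟨i, hi, rfl⟩, ⟨i, hi, Sym2.eq_swap⟩]
  choose g hgM hg using hex
  have hinj : Function.Injective g := fun e e' h => Subtype.ext (by rw [← hg, ← hg, h])
  refine ⟨Finset.univ.image g, ?_, ?_, ?_⟩
  · intro i hi
    obtain ⟨e, -, rfl⟩ := Finset.mem_image.1 hi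
    exact hgM e
  · refine hTree.connected.mono fun u v huv => ?_
    have h := hg ⟨s(u, v), huv⟩
    have hmem : g ⟨s(u, v), huv⟩ ∈ Finset.univ.image g :=
      Finset.mem_image_of_mem _ (Finset.mem_univ _)
    refine (SimpleGraph.fromRel_adj _ _ _).2 ⟨huv.ne, ?_⟩
    rcases Sym2.eq_iff.1 h with h | h
    exacts [.inl ⟨_, hmem, h⟩, .inr ⟨_, hmem, h⟩]
  · rw [Finset.card_image_of_injective _ hinj, ← hTree.card_edgeFinset, Finset.card_univ,
      SimpleGraph.edgeFinset_card]

theorem treeWeight_le_of_subset (color : Fin k → TwistColor) {F M : Finset (Fin k)} (h : F ⊆ M) :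
    treeWeight color M ≤ treeWeight color F + (M.card - F.card) := by
  classical
  rw [← Finset.card_sdiff_of_subset h]
  unfold treeWeight
  have h1 : (Finset.univ.filter fun i => i ∈ M ∧ color i = .sheaf).card ≤
      (Finset.univ.filter fun i => i ∈ F ∧ color i = .sheaf).card + (M \ F).card := by
    refine (Finset.card_le_card fun i hi => ?_).trans (Finset.card_union_le _ _)
    simp only [Finset.mem_filter, Finset.mem_union, Finset.mem_sdiff, Finset.mem_univ] at hi ⊢
    tauto
  have h2 : (Finset.univ.filter fun i => i ∉ M ∧ color i = .chain).card ≤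
      (Finset.univ.filter fun i => i ∉ F ∧ color i = .chain).card := by
    refine Finset.card_le_card fun i hi => ?_
    simp only [Finset.mem_filter, Finset.mem_univ] at hi ⊢
    exact ⟨trivial, fun hF => hi.2.1 (h hF), hi.2.2⟩
  convert (Nat.add_le_add h1 h2).trans (le_of_eq (Nat.add_right_comm _ _ _)) using 3

theorem treeWeight_le_insert (color : Fin k → TwistColor) (M : Finset (Fin k)) (i : Fin k) :
    treeWeight color M ≤ treeWeight color (insert i M) + 1 := by
  classical
  unfold treeWeight
  have h1 : (Finset.univ.filter fun j => j ∈ M ∧ color j = .sheaf).card ≤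
      (Finset.univ.filter fun j => j ∈ insert i M ∧ color j = .sheaf).card := by
    refine Finset.card_le_card fun j hj => ?_
    simp only [Finset.mem_filter, Finset.mem_univ, Finset.mem_insert] at hj ⊢
    tauto
  have h2 : (Finset.univ.filter fun j => j ∉ M ∧ color j = .chain).card ≤
      (Finset.univ.filter fun j => j ∉ insert i M ∧ color j = .chain).card + 1 := by
    refine (Finset.card_le_card fun j hj => ?_).trans (Finset.card_insert_le i _)
    simp only [Finset.mem_filter, Finset.mem_univ, Finset.mem_insert] at hj ⊢
    tauto
  convert (Nat.add_le_add h1 h2).trans (le_of_eq (Nat.add_assoc _ _ _).symm) using 3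

theorem treeWeight_le (color : Fin k → TwistColor) (M : Finset (Fin k)) :
    treeWeight color M ≤ k := by
  classical
  unfold treeWeight
  rw [← Finset.card_union_of_disjoint]
  · exact (Finset.card_le_univ _).trans (by simp)
  · rw [Finset.disjoint_filter]
    tauto

theorem maxTreeWeight_le (color : Fin k → TwistColor) : G.maxTreeWeight color ≤ k := by
  unfold maxTreeWeight
  exact Finset.sup_le fun M _ => treeWeight_le color M

theorem IsSpanningTree.treeWeight_le_maxTreeWeight (color : Fin k → TwistColor)
    {F : Finset (Fin k)} (hF : G.IsSpanningTree F) :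
    treeWeight color F ≤ G.maxTreeWeight color := by
  unfold maxTreeWeight
  exact Finset.le_sup (by simpa using hF)

/-- The case of `treeWeight_add_one_le_maxTreeWeight_add_numBoundary` in which `M` is connected: then
`M` consists of a spanning tree and of `M.card - V + 1` further edges, and Euler's formula for `G`
bounds the number of boundary components of `M` from below by `M.card - V + 2`. -/
theorem treeWeight_add_one_le_of_connected (hG : G.Connected) (hplane : G.IsPlane)
    (color : Fin k → TwistColor) {M : Finset (Fin k)} (hM : (G.subgraph M).Connected) :
    treeWeight color M + 1 ≤ G.maxTreeWeight color + G.numBoundary M := by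
  obtain ⟨F, hFM, hF⟩ := exists_isSpanningTree_subset hM
  have h1 := treeWeight_le_of_subset color hFM
  have h2 := hF.treeWeight_le_maxTreeWeight color
  have h3 := hF.2
  have h4 := G.numBoundary_union_le M Mᶜ
  rw [Finset.union_compl, numBoundary_univ, Finset.card_compl, Fintype.card_fin] at h4
  have h5 : Fintype.card G.Vert + G.numFaces = k + 2 := by
    have : Nat.card (G.subgraph Finset.univ).ConnectedComponent = 1 := by
      have := hG.preconnected.subsingleton_connectedComponent
      have := hG.nonempty
      exact Nat.card_unique
    rw [IsPlane, this] at hplane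
    exact hplane
  have h6 := Finset.card_le_card hFM
  have h7 : M.card ≤ k := (Finset.card_le_univ M).trans (by simp)
  omega

/-- The number `b` of boundary components of `M` is large enough for `d ^ (p + b - 1)` to absorb one
factor `d⁻¹` for each edge that counts in the weight of `M`: an edge that joins two components of `M`
lowers `b` by one, and the weight by at most one. -/
theorem treeWeight_add_one_le_maxTreeWeight_add_numBoundary (hG : G.Connected) (hplane : G.IsPlane)
    (color : Fin k → TwistColor) (M : Finset (Fin k)) :
    treeWeight color M + 1 ≤ G.maxTreeWeight color + G.numBoundary M := by
  by_cases hM : (G.subgraph M).Connected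
  · exact treeWeight_add_one_le_of_connected hG hplane color hM
  · obtain ⟨i, hi⟩ := exists_not_reachable hG hM
    have hiM : i ∉ M := fun h => hi (G.reachable_src h)
    have h1 := treeWeight_add_one_le_maxTreeWeight_add_numBoundary hG hplane color (insert i M)
    have h2 := G.numBoundary_insert_add_one_le hi
    have h3 := treeWeight_le_insert color M i
    omega
termination_by Mᶜ.card
decreasing_by
  apply Finset.card_lt_card
  rw [Finset.compl_ssubset_compl]
  exact Finset.ssubset_insert hiM

/-- If twist equivalent crossings lie at the same twist site, then there are at least as many twist
equivalence classes as sites. -/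
theorem maxTreeWeight_le_twistNumber (color : Fin k → TwistColor) (t : Fin k → ℤ)
    (ht : ∀ i, t i ≠ 0)
    (h : ∀ x y : (G.diagram color t).Crossing,
      (G.diagram color t).TwistEquivalent x y → x.1 = y.1) :
    G.maxTreeWeight color ≤ (G.diagram color t).twistNumber := by
  have : Finite (Quot (G.diagram color t).TwistEquivalent) := Quot.finite _
  have := Nat.card_le_card_of_surjective
    (Quot.lift (fun x : (G.diagram color t).Crossing => (x.1 : Fin k)) h)
    fun i => ⟨Quot.mk _ ⟨i, ⟨0, Int.natAbs_pos.2 (ht i)⟩⟩, rfl⟩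
  rw [Nat.card_fin] at this
  exact (maxTreeWeight_le color).trans this

end EmbeddedGraph

/-! ### The curves in a state of `D_t` -/

section LevelCount

variable {n : ℕ} (χ : Fin n → Bool)

/-- The number of `true` values of `χ`. -/
def trueCount : ℕ := (Finset.univ.filter fun j => χ j = true).card

/-- The number of `true` values of `χ` among the first `l` values. -/
def levelCount (l : ℕ) : ℕ := (Finset.univ.filter fun j : Fin n => j.val < l ∧ χ j = true).card

theorem trueCount_ne_zero {j : Fin n} (h : χ j = true) : trueCount χ ≠ 0 :=
  Finset.card_ne_zero_of_mem (Finset.mem_filter.2 ⟨Finset.mem_univ j, h⟩)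

theorem levelCount_zero : levelCount χ 0 = 0 := by simp [levelCount]

theorem levelCount_self : levelCount χ n = trueCount χ := by simp [levelCount, trueCount]

theorem levelCount_succ (j : Fin n) :
    levelCount χ (j.val + 1) = levelCount χ j + if χ j = true then 1 else 0 := by
  have h : (Finset.univ.filter fun i : Fin n => i.val < j.val + 1 ∧ χ i = true) =
      (Finset.univ.filter fun i : Fin n => i.val < j.val ∧ χ i = true) ∪
        Finset.univ.filter fun i => i = j ∧ χ i = true := by
    ext i
    simp only [Finset.mem_filter, Finset.mem_union, Finset.mem_univ, true_and, Fin.ext_iff, ← or_and_right,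
      Nat.lt_succ_iff, Nat.le_iff_lt_or_eq]
  have h' : (Finset.univ.filter fun i => i = j ∧ χ i = true) = if χ j = true then {j} else ∅ := by
    ext i
    split_ifs with hj <;> simp only [Finset.mem_filter, Finset.mem_univ, true_and,
      Finset.mem_singleton, Finset.notMem_empty, iff_false]
    · exact ⟨And.left, fun h => ⟨h, h ▸ hj⟩⟩
    · rintro ⟨rfl, hi⟩
      exact hj hi
  rw [levelCount, h, Finset.card_union_of_disjoint, h']
  · split_ifs <;> simp [levelCount]
  · rw [Finset.disjoint_filter]
    rintro i - ⟨h1, -⟩ ⟨rfl, -⟩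
    exact lt_irrefl _ h1

theorem levelCount_mono : Monotone (levelCount χ) := fun _ _ h =>
  Finset.card_le_card (Finset.monotone_filter_right _ fun _ _ hj => ⟨hj.1.trans_le h, hj.2⟩)

theorem exists_levelCount_eq {c : ℕ} (hc : c ≤ trueCount χ) :
    ∃ l : Fin (n + 1), levelCount χ l = c := by
  suffices ∀ L ≤ n, c ≤ levelCount χ L → ∃ l : Fin (n + 1), levelCount χ l = c from
    this n le_rfl (by rwa [levelCount_self])
  intro L
  induction L with
  | zero => exact fun _ h => ⟨0, by rw [levelCount_zero] at h; simp [levelCount_zero]; omega⟩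
  | succ L ih =>
    intro hL h
    by_cases h' : c ≤ levelCount χ L
    · exact ih (by omega) h'
    · have := levelCount_succ χ ⟨L, hL⟩
      simp only at this
      refine ⟨⟨L + 1, by omega⟩, ?_⟩
      simp only
      split_ifs at this <;> omega

end LevelCount

namespace EmbeddedGraph

/-- Whether the smoothing `b` of a crossing with the sign of `n`, at a twist site of the color `c`,
cuts the two rails and reconnects them across, as opposed to leaving the two rails parallel. For fixed
`c` and `n` this is an involution, so that it also computes `b` from the answer. -/
def cutsRails : TwistColor → ℤ → Bool → Bool
  | .chain, n, b => b ^^ decide (0 ≤ n)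
  | .sheaf, n, b => b ^^ !decide (0 ≤ n)

theorem cutsRails_cutsRails (c : TwistColor) (n : ℤ) (b : Bool) :
    cutsRails c n (cutsRails c n b) = b := by
  cases c <;> simp [cutsRails]

theorem port_smoothing (c : TwistColor) (n : ℤ) (b : Bool) (a : Fin 4) :
    port c n (LinkDiagram.smoothing b a) =
      if cutsRails c n b then ((port c n a).1, !(port c n a).2)
      else (!(port c n a).1, (port c n a).2) := by
  by_cases h : 0 ≤ n <;> cases c <;>
    simp only [port, cutsRails, h, if_true, if_false, decide_true, decide_false] <;>
    clear h <;> revert a b <;> decide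

variable {k : ℕ} (G : EmbeddedGraph k) (color : Fin k → TwistColor) {t : Fin k → ℤ}
  (χ : ∀ i, Fin (t i).natAbs → Bool)

/-- The state of `D_t` in which exactly the crossings with `χ i j = true` cut the rails. -/
def railState (x : TwistCrossing t) : Bool := cutsRails (color x.1) (t x.1) (χ x.1 x.2)

open Classical in
/-- The edges whose two ends are merged when exactly the sites `i` with `κ i = true` have a crossing
that cuts the rails: the chains without a cut, and the sheaves with at least one. -/
def mergedOf (κ : Fin k → Bool) : Finset (Fin k) :=
  Finset.univ.filter fun i => color i = .sheaf ↔ κ i = true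

/-- The edges whose two ends are merged in the state `railState color χ`. -/
def mergedEdges : Finset (Fin k) := mergedOf color fun i => decide (trueCount (χ i) ≠ 0)

theorem mem_mergedEdges (i : Fin k) :
    i ∈ mergedEdges color χ ↔ (color i = .sheaf ↔ trueCount (χ i) ≠ 0) := by
  simp [mergedEdges, mergedOf]

/-- The half-edges of `D_t`. -/
abbrev DiagramHalfEdge (t : Fin k → ℤ) : Type :=
  TwistCrossing t × Fin 4 ⊕ G.TwistJoint t × Bool

/-- The curves of the state `railState color χ`. -/
abbrev StateLoops : Type :=
  Quot fun g h : G.DiagramHalfEdge t =>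
    h = G.diagramGlue color t g ∨ h = (G.diagram color t).connect (railState color χ) g

/-- The labels of the curves of a state: the boundary components of the ribbon graph with the merged
edges, the circles around isolated vertices, and the circles between consecutive cuts of a twist
site. -/
abbrev LoopLabel : Type :=
  (G.boundaryPerm (mergedEdges color χ)).Orbits ⊕ G.Isolated ⊕ Σ i, Fin (trueCount (χ i) - 1)

/-- The boundary component of the ribbon graph with edge set `M` to which an outer corner belongs; a
dart stands for the corner on its left. -/
def cornerClass (M : Finset (Fin k)) (c : (Fin k × Bool) × Bool) : (G.boundaryPerm M).Orbits :=
  if c.2 = c.1.2 then Quot.mk _ c.1 else Quot.mk _ (G.rot.symm c.1)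

theorem cornerClass_medialArc (M : Finset (Fin k)) (c : (Fin k × Bool) × Bool) :
    G.cornerClass M (G.medialArc c) = G.cornerClass M c := by
  by_cases h : c.2 = c.1.2
  · simp [cornerClass, medialArc, h]
  · simp [cornerClass, medialArc, h]

theorem mk_eq_mk_rot_symm (M : Finset (Fin k)) (a : Fin k × Bool) :
    (Quot.mk _ a : (G.boundaryPerm M).Orbits) = Quot.mk _ (G.rot.symm (edgeFlip M a)) :=
  Quot.sound rfl

theorem cornerClass_of_mem {M : Finset (Fin k)} {i : Fin k} (hi : i ∈ M) (e e' s : Bool) :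
    G.cornerClass M ((i, e), s) = G.cornerClass M ((i, e'), s) := by
  have h := fun e => G.mk_eq_mk_rot_symm M (i, e)
  simp only [edgeFlip_apply, hi, if_true] at h
  cases e <;> cases e' <;> cases s <;> simp [cornerClass, h false, h true]

theorem cornerClass_of_notMem {M : Finset (Fin k)} {i : Fin k} (hi : i ∉ M) (e s s' : Bool) :
    G.cornerClass M ((i, e), s) = G.cornerClass M ((i, e), s') := by
  have h := fun e => G.mk_eq_mk_rot_symm M (i, e)
  simp only [edgeFlip_apply, hi, if_false] at h
  cases e <;> cases s <;> cases s' <;> simp [cornerClass, ← h false, ← h true]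

/-- The boundary component at the pair `q = (end, rail)` of the site `i`. -/
def outerClass (i : Fin k) (q : Bool × Bool) : (G.boundaryPerm (mergedEdges color χ)).Orbits :=
  G.cornerClass _ ((i, (railing (color i) q).1), (railing (color i) q).2)

theorem outerClass_of_ne {i : Fin k} (h : trueCount (χ i) ≠ 0) (e r r' : Bool) :
    G.outerClass color χ i (e, r) = G.outerClass color χ i (e, r') := by
  have hm := mem_mergedEdges color χ i
  unfold outerClass
  cases hc : color i with
  | chain => exact G.cornerClass_of_notMem (by simp [hm, hc, h]) _ _ _
  | sheaf => exact G.cornerClass_of_mem (by simp [hm, hc, h]) _ _ _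

theorem outerClass_of_eq {i : Fin k} (h : trueCount (χ i) = 0) (e e' r : Bool) :
    G.outerClass color χ i (e, r) = G.outerClass color χ i (e', r) := by
  have hm := mem_mergedEdges color χ i
  unfold outerClass
  cases hc : color i with
  | chain => exact G.cornerClass_of_mem (by simp [hm, hc, h]) _ _ _
  | sheaf => exact G.cornerClass_of_notMem (by simp [hm, hc, h]) _ _ _

/-- The label of the curve through the joint at the level `l` of the rail `r` of the site `i`. It
depends on the number of cuts below the level `l`. -/
def jointLabel (i : Fin k) (l : ℕ) (r : Bool) : G.LoopLabel color χ :=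
  if h : levelCount (χ i) l = 0 then .inl (G.outerClass color χ i (false, r))
  else if h' : levelCount (χ i) l < trueCount (χ i) then
    .inr (.inr ⟨i, ⟨levelCount (χ i) l - 1, by omega⟩⟩)
  else .inl (G.outerClass color χ i (true, r))

theorem jointLabel_outer (i : Fin k) (q : Bool × Bool) :
    G.jointLabel color χ i (if q.1 then Fin.last (t i).natAbs else 0 : Fin _) q.2 =
      .inl (G.outerClass color χ i q) := by
  obtain ⟨_ | _, r⟩ := q
  · simp [jointLabel, levelCount_zero]
  · by_cases h : trueCount (χ i) = 0
    · simp [jointLabel, levelCount_self, h, G.outerClass_of_eq color χ h false true]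
    · simp [jointLabel, levelCount_self, h]

theorem jointLabel_castSucc_eq_succ {i : Fin k} {j : Fin (t i).natAbs} (h : χ i j = false)
    (r : Bool) :
    G.jointLabel color χ i j.castSucc r = G.jointLabel color χ i j.succ r := by
  have := levelCount_succ (χ i) j
  simp only [h, Bool.false_eq_true, if_false, add_zero] at this
  simp [jointLabel, this]

theorem jointLabel_of_ne {i : Fin k} (h : trueCount (χ i) ≠ 0) (l : ℕ) (r r' : Bool) :
    G.jointLabel color χ i l r = G.jointLabel color χ i l r' := by
  simp [jointLabel, G.outerClass_of_ne color χ h _ r r']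

/-- The label of the curve through a half-edge. -/
def halfEdgeLabel : G.DiagramHalfEdge t → G.LoopLabel color χ
  | .inl (⟨i, j⟩, a) => G.jointLabel color χ i
      (if (port (color i) (t i) a).1 then j.succ else j.castSucc : Fin _)
      (port (color i) (t i) a).2
  | .inr (.inl ⟨i, (l, r)⟩, _) => G.jointLabel color χ i l r
  | .inr (.inr v, _) => .inr (.inl v)

theorem halfEdgeLabel_outerGlue (i : Fin k) (q : Bool × Bool) :
    G.halfEdgeLabel color χ (G.outerGlue color t i q) = .inl (G.outerClass color χ i q) := by
  unfold outerGlue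
  refine (G.jointLabel_outer color χ _ _).trans ?_
  simp only [outerClass, railing_railing]
  exact congrArg _ (G.cornerClass_medialArc _ _)

theorem halfEdgeLabel_glue (h : G.DiagramHalfEdge t) :
    G.halfEdgeLabel color χ (G.diagramGlue color t h) = G.halfEdgeLabel color χ h := by
  rcases h with ⟨⟨i, j⟩, a⟩ | ⟨⟨i, l, r⟩ | v, _ | _⟩
  · rfl
  · by_cases h : l = 0
    · subst h
      simp only [diagramGlue, dif_pos, halfEdgeLabel_outerGlue]
      exact (G.jointLabel_outer color χ i (false, r)).symm
    · simp [diagramGlue, h, halfEdgeLabel]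
  · by_cases h : l.val < (t i).natAbs
    · simp [diagramGlue, h, halfEdgeLabel]
    · have : l = Fin.last _ := Fin.ext (by have := l.isLt; simp only [Fin.val_last]; omega)
      subst this
      simp only [diagramGlue, h, dif_neg, not_false_iff, halfEdgeLabel_outerGlue]
      exact (G.jointLabel_outer color χ i (true, r)).symm
  · rfl
  · rfl

theorem halfEdgeLabel_connect (h : G.DiagramHalfEdge t) :
    G.halfEdgeLabel color χ ((G.diagram color t).connect (railState color χ) h) =
      G.halfEdgeLabel color χ h := by
  rcases h with ⟨⟨i, j⟩, a⟩ | ⟨⟨i, l, r⟩ | v, b⟩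
  · have hp := port_smoothing (color i) (t i) (railState color χ ⟨i, j⟩) a
    rw [railState, cutsRails_cutsRails] at hp
    change G.jointLabel color χ i
      (if (port (color i) (t i) (LinkDiagram.smoothing (railState color χ ⟨i, j⟩) a)).1
        then j.succ else j.castSucc : Fin _)
      (port (color i) (t i) (LinkDiagram.smoothing (railState color χ ⟨i, j⟩) a)).2 =
      G.jointLabel color χ i
        (if (port (color i) (t i) a).1 then j.succ else j.castSucc : Fin _)
        (port (color i) (t i) a).2
    rw [railState, hp]
    cases hχ : χ i j with
    | true => exact G.jointLabel_of_ne color χ (trueCount_ne_zero _ hχ) _ _ _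
    | false =>
      have := G.jointLabel_castSucc_eq_succ color χ hχ (port (color i) (t i) a).2
      cases (port (color i) (t i) a).1
      exacts [this.symm, this]
  · rfl
  · rfl

/-- The map from curves to labels. -/
def loopLabel : G.StateLoops color χ → G.LoopLabel color χ :=
  Quot.lift (G.halfEdgeLabel color χ) (by
    rintro g _ (rfl | rfl)
    exacts [(G.halfEdgeLabel_glue color χ g).symm, (G.halfEdgeLabel_connect color χ g).symm])

/-- The curve through the joint at the level `l` of the rail `r` of the site `i`. -/
def jointLoop (i : Fin k) (l : Fin ((t i).natAbs + 1)) (r : Bool) : G.StateLoops color χ :=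
  Quot.mk _ (.inr (.inl ⟨i, (l, r)⟩, false))

theorem mk_joint (i : Fin k) (l : Fin ((t i).natAbs + 1)) (r b : Bool) :
    (Quot.mk _ (.inr (.inl ⟨i, (l, r)⟩, b)) : G.StateLoops color χ) = G.jointLoop color χ i l r := by
  cases b
  · rfl
  · exact Quot.sound (.inr rfl)

theorem mk_crossing (i : Fin k) (j : Fin (t i).natAbs) (a : Fin 4) :
    (Quot.mk _ (.inl (⟨i, j⟩, a)) : G.StateLoops color χ) =
      G.jointLoop color χ i (if (port (color i) (t i) a).1 then j.succ else j.castSucc)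
        (port (color i) (t i) a).2 := by
  rw [← G.mk_joint color χ _ _ _ (!(port (color i) (t i) a).1)]
  exact Quot.sound (.inl rfl)

theorem jointLoop_connect (i : Fin k) (j : Fin (t i).natAbs) (e r : Bool) :
    G.jointLoop color χ i (if e then j.succ else j.castSucc) r =
      if χ i j = true then G.jointLoop color χ i (if e then j.succ else j.castSucc) (!r)
      else G.jointLoop color χ i (if e then j.castSucc else j.succ) r := by
  obtain ⟨a, ha⟩ := (port (color i) (t i)).surjective (e, r)
  have hp := port_smoothing (color i) (t i) (railState color χ ⟨i, j⟩) a
  rw [railState, cutsRails_cutsRails, ha] at hp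
  have h1 := G.mk_crossing color χ i j a
  have h2 := G.mk_crossing color χ i j (LinkDiagram.smoothing (railState color χ ⟨i, j⟩) a)
  rw [ha] at h1
  rw [railState, hp] at h2
  rw [← h1]
  refine (Quot.sound (.inr rfl) : _ = Quot.mk _ (.inl (⟨i, j⟩,
    LinkDiagram.smoothing (railState color χ ⟨i, j⟩) a))).trans (h2.trans ?_)
  cases χ i j <;> cases e <;> rfl

/-- Without a cut between the levels `l` and `l'`, each rail stays on one curve between them. -/
theorem jointLoop_eq_of_levelCount_eq {i : Fin k} {l l' : Fin ((t i).natAbs + 1)}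
    (h : levelCount (χ i) l = levelCount (χ i) l') (r : Bool) :
    G.jointLoop color χ i l r = G.jointLoop color χ i l' r := by
  suffices ∀ l l' : ℕ, l ≤ l' → ∀ (hl : l < (t i).natAbs + 1) (hl' : l' < (t i).natAbs + 1),
      levelCount (χ i) l = levelCount (χ i) l' →
      G.jointLoop color χ i ⟨l, hl⟩ r = G.jointLoop color χ i ⟨l', hl'⟩ r by
    rcases le_total l l' with hle | hle
    exacts [this _ _ hle _ _ h, (this _ _ hle _ _ h.symm).symm]
  intro l l' hle
  induction l', hle using Nat.le_induction with
  | base => intros; rfl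
  | succ m hm ih =>
    intro hl hl' hc
    have h1 := levelCount_mono (χ i) hm
    have h2 := levelCount_succ (χ i) ⟨m, by omega⟩
    simp only at h2
    have h3 : ¬ χ i ⟨m, by omega⟩ = true := by
      intro h3
      rw [if_pos h3] at h2
      omega
    rw [if_neg h3, add_zero] at h2
    rw [ih hl (by omega) (by omega)]
    have := G.jointLoop_connect color χ i ⟨m, by omega⟩ false r
    rwa [if_neg h3] at this

/-- At a site with a cut, both rails belong to the same curve at any level. -/
theorem jointLoop_eq_of_ne {i : Fin k} (h : trueCount (χ i) ≠ 0) (l : Fin ((t i).natAbs + 1))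
    (r r' : Bool) : G.jointLoop color χ i l r = G.jointLoop color χ i l r' := by
  -- the two rails are connected on either side of a cut, so it suffices to move along both of them
  -- to the nearest cut
  have hcut : ∀ (j : Fin (t i).natAbs) (e : Bool), χ i j = true → ∀ r r',
      G.jointLoop color χ i (if e then j.succ else j.castSucc) r =
        G.jointLoop color χ i (if e then j.succ else j.castSucc) r' := by
    intro j e hj r r'
    have := fun r => G.jointLoop_connect color χ i j e r
    simp only [hj, if_true] at this
    cases r <;> cases r'
    exacts [rfl, this false, this true, rfl]
  have hex : ∀ m : ℕ, ∀ hm : m ≤ (t i).natAbs, levelCount (χ i) m ≠ 0 → ∃ j, χ i j = true ∧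
      levelCount (χ i) (j.val + 1) = levelCount (χ i) m := by
    intro m
    induction m with
    | zero => exact fun _ h => absurd (levelCount_zero _) h
    | succ m ih =>
      intro hm hc
      have h2 := levelCount_succ (χ i) ⟨m, hm⟩
      by_cases hj : χ i ⟨m, hm⟩ = true
      · exact ⟨⟨m, hm⟩, hj, rfl⟩
      · rw [if_neg hj, add_zero] at h2
        simp only at h2
        rw [h2] at hc ⊢
        exact ih (by omega) hc
  by_cases h0 : levelCount (χ i) l = 0
  · -- there is no cut below the level `l`, so the rails lead to the first cut above it
    obtain ⟨l', hl'⟩ := exists_levelCount_eq (χ i) (Nat.one_le_iff_ne_zero.2 h)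
    obtain ⟨j, hj, hc⟩ := hex l' (by omega) (by omega)
    have h2 := levelCount_succ (χ i) j
    rw [if_pos hj] at h2
    have h3 : levelCount (χ i) l = levelCount (χ i) j.castSucc := by
      simp only [Fin.val_castSucc]
      omega
    rw [G.jointLoop_eq_of_levelCount_eq color χ h3, G.jointLoop_eq_of_levelCount_eq color χ h3]
    exact hcut j false hj r r'
  · -- the rails lead to the last cut below the level `l`
    obtain ⟨j, hj, hc⟩ := hex l (by omega) h0
    have h3 : levelCount (χ i) l = levelCount (χ i) j.succ := by
      simp only [Fin.val_succ]
      omega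
    rw [G.jointLoop_eq_of_levelCount_eq color χ h3, G.jointLoop_eq_of_levelCount_eq color χ h3]
    exact hcut j true hj r r'

/-- The curve through the outer corner `c`. -/
def cornerLoop (c : (Fin k × Bool) × Bool) : G.StateLoops color χ :=
  Quot.mk _ (G.outer t c.1.1 (railing (color c.1.1) (c.1.2, c.2)))

theorem cornerLoop_medialArc (c : (Fin k × Bool) × Bool) :
    G.cornerLoop color χ (G.medialArc c) = G.cornerLoop color χ c := by
  refine (Quot.sound (.inl ?_)).symm
  rw [diagramGlue_outer, outerGlue, railing_railing]

theorem cornerLoop_eq (c : (Fin k × Bool) × Bool) :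
    G.cornerLoop color χ c = G.jointLoop color χ c.1.1
      (if (railing (color c.1.1) (c.1.2, c.2)).1 then Fin.last _ else 0)
      (railing (color c.1.1) (c.1.2, c.2)).2 :=
  G.mk_joint color χ _ _ _ _

theorem jointLoop_zero_eq_last {i : Fin k} (h : trueCount (χ i) = 0) (r : Bool) :
    G.jointLoop color χ i 0 r = G.jointLoop color χ i (Fin.last _) r := by
  apply jointLoop_eq_of_levelCount_eq
  simp [levelCount_zero, levelCount_self, h]

theorem cornerLoop_of_mem {i : Fin k} (hi : i ∈ mergedEdges color χ) (e e' s : Bool) :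
    G.cornerLoop color χ ((i, e), s) = G.cornerLoop color χ ((i, e'), s) := by
  rw [mem_mergedEdges] at hi
  rw [cornerLoop_eq, cornerLoop_eq]
  cases hc : color i with
  | chain =>
    have h : trueCount (χ i) = 0 := by simpa [hc] using hi
    have := G.jointLoop_zero_eq_last color χ h s
    cases e <;> cases e' <;> simp [railing, this]
  | sheaf =>
    have h : trueCount (χ i) ≠ 0 := by simpa [hc] using hi
    exact G.jointLoop_eq_of_ne color χ h _ e e'

theorem cornerLoop_of_notMem {i : Fin k} (hi : i ∉ mergedEdges color χ) (e s s' : Bool) :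
    G.cornerLoop color χ ((i, e), s) = G.cornerLoop color χ ((i, e), s') := by
  rw [mem_mergedEdges] at hi
  rw [cornerLoop_eq, cornerLoop_eq]
  cases hc : color i with
  | chain =>
    have h : trueCount (χ i) ≠ 0 := by simpa [hc] using hi
    exact G.jointLoop_eq_of_ne color χ h _ s s'
  | sheaf =>
    have h : trueCount (χ i) = 0 := by simpa [hc] using hi
    have := G.jointLoop_zero_eq_last color χ h e
    cases s <;> cases s' <;> simp [railing, this]

/-- The map from labels to curves, a left inverse of `loopLabel`; the circle after the cut number
`c + 1` of a site passes through any level with exactly `c + 1` cuts below it. -/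
def labelLoop : G.LoopLabel color χ → G.StateLoops color χ
  | .inl q => Quot.lift (fun a => G.cornerLoop color χ (a, a.2)) (by
      intro x y hxy
      rw [eq_boundaryPerm_iff] at hxy
      rw [← G.cornerLoop_medialArc color χ (y, y.2)]
      simp only [medialArc, if_true, hxy, edgeFlip_apply]
      obtain ⟨i, e⟩ := x
      by_cases hi : i ∈ mergedEdges color χ
      · simp only [hi, if_true, Bool.not_not]
        exact G.cornerLoop_of_mem color χ hi _ _ _
      · simp only [hi, if_false]
        exact G.cornerLoop_of_notMem color χ hi _ _ _) q
  | .inr (.inl v) => Quot.mk _ (.inr (.inr v, false))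
  | .inr (.inr ⟨i, c⟩) => G.jointLoop color χ i
      (exists_levelCount_eq (χ i) (c := c + 1) (by omega)).choose false

theorem labelLoop_cornerClass (c : (Fin k × Bool) × Bool) :
    G.labelLoop color χ (.inl (G.cornerClass _ c)) = G.cornerLoop color χ c := by
  by_cases h : c.2 = c.1.2
  · obtain ⟨a, s⟩ := c
    simp only at h
    subst h
    rw [cornerClass, if_pos rfl]
    rfl
  · rw [← G.cornerLoop_medialArc, cornerClass, if_neg h, medialArc, if_neg h]
    rfl

theorem labelLoop_outerClass (i : Fin k) (q : Bool × Bool) :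
    G.labelLoop color χ (.inl (G.outerClass color χ i q)) =
      G.jointLoop color χ i (if q.1 then Fin.last _ else 0) q.2 := by
  rw [outerClass, labelLoop_cornerClass, cornerLoop_eq]
  simp only [Prod.mk.eta, railing_railing]

theorem labelLoop_jointLabel (i : Fin k) (l : Fin ((t i).natAbs + 1)) (r : Bool) :
    G.labelLoop color χ (G.jointLabel color χ i l r) = G.jointLoop color χ i l r := by
  unfold jointLabel
  split_ifs with h h'
  · rw [labelLoop_outerClass]
    apply jointLoop_eq_of_levelCount_eq
    simp [h, levelCount_zero]
  · have hs := (exists_levelCount_eq (χ i) (c := levelCount (χ i) l - 1 + 1) (by omega)).choose_spec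
    refine Eq.trans ?_ (G.jointLoop_eq_of_ne color χ (by omega) l false r)
    refine G.jointLoop_eq_of_levelCount_eq color χ (hs.trans ?_) false
    omega
  · rw [labelLoop_outerClass]
    apply jointLoop_eq_of_levelCount_eq
    have h1 := levelCount_mono (χ i) (Nat.le_of_lt_succ l.isLt)
    rw [levelCount_self] at h1
    simp only [if_true, Fin.val_last, levelCount_self]
    omega

theorem labelLoop_loopLabel (q : G.StateLoops color χ) :
    G.labelLoop color χ (G.loopLabel color χ q) = q := by
  rcases q with ⟨⟨⟨i, j⟩, a⟩ | ⟨⟨i, l, r⟩ | v, b⟩⟩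
  · exact (G.labelLoop_jointLabel color χ _ _ _).trans (G.mk_crossing color χ i j a).symm
  · exact (G.labelLoop_jointLabel color χ _ _ _).trans (G.mk_joint color χ i l r b).symm
  · cases b
    · rfl
    · exact Quot.sound (.inr rfl)

theorem loopLabel_surjective : Function.Surjective (G.loopLabel color χ) := by
  rintro (q | v | ⟨i, c⟩)
  · induction q using Quot.ind with | mk a
    refine ⟨G.cornerLoop color χ (a, a.2), ?_⟩
    refine (G.jointLabel_outer color χ _ _).trans ?_
    rw [outerClass, railing_railing, cornerClass, if_pos rfl]
  · exact ⟨Quot.mk _ (.inr (.inr v, false)), rfl⟩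
  · obtain ⟨l, hl⟩ := exists_levelCount_eq (χ i) (c := c + 1) (by omega)
    refine ⟨G.jointLoop color χ i l false, ?_⟩
    change G.jointLabel color χ i l false = _
    have := c.isLt
    rw [jointLabel, dif_neg (by omega), dif_pos (by omega)]
    congr
    omega

/-- The number of curves of a state of `D_t`. -/
theorem loops_railState :
    (G.diagram color t).loops (railState color χ) =
      G.numBoundary (mergedEdges color χ) + ∑ i, (trueCount (χ i) - 1) := by
  have hb : Function.Bijective (G.loopLabel color χ) :=
    ⟨Function.LeftInverse.injective (G.labelLoop_loopLabel color χ),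
      G.loopLabel_surjective color χ⟩
  have h1 : (G.diagram color t).loops (railState color χ) = Nat.card (G.StateLoops color χ) := rfl
  rw [h1, Nat.card_eq_of_bijective _ hb, Nat.card_sum, Nat.card_sum, ← add_assoc, numBoundary,
    Nat.card_sigma]
  simp

end EmbeddedGraph

/-! ### The bracket of `D_t` -/

section SiteSum

variable (n : ℕ) (ε : ℤ)

/-- The contribution of a twist site with `n` crossings to the bracket, where `A ^ ε` is the weight of
a smoothing that keeps the rails: the sum over the states of the site without a cut (`b = false`), or
with at least one cut (`b = true`). There is a circle between any two consecutive cuts. -/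
def siteSum (b : Bool) : ℂ[T;T⁻¹] :=
  ∑ χ : Fin n → Bool with decide (trueCount χ ≠ 0) = b,
    (∏ j, T (if χ j = true then -ε else ε)) * kauffmanD ^ (trueCount χ - 1)

theorem trueCount_eq_zero_iff {n : ℕ} {χ : Fin n → Bool} :
    trueCount χ = 0 ↔ χ = fun _ => false := by
  simp [trueCount, Finset.filter_eq_empty_iff, funext_iff]

theorem siteSum_false : siteSum n ε false = T ε ^ n := by
  have h : (Finset.univ.filter fun χ : Fin n → Bool => decide (trueCount χ ≠ 0) = false) =
      {fun _ => false} := by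
    ext χ
    simp [trueCount_eq_zero_iff]
  rw [siteSum, h, Finset.sum_singleton, trueCount_eq_zero_iff.2 rfl]
  simp

theorem kauffmanD_mul_siteSum_true :
    kauffmanD * siteSum n ε true = (T ε + T (-ε) * kauffmanD) ^ n - T ε ^ n := by
  have hall : ∑ χ : Fin n → Bool, (∏ j, T (if χ j = true then -ε else ε)) *
      kauffmanD ^ trueCount χ = (T ε + T (-ε) * kauffmanD) ^ n := by
    have h1 : ∀ χ : Fin n → Bool, (∏ j, T (if χ j = true then -ε else ε)) *
        kauffmanD ^ trueCount χ = ∏ j, if χ j = true then T (-ε) * kauffmanD else T ε := by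
      intro χ
      rw [trueCount, ← Finset.prod_const, Finset.prod_filter, ← Finset.prod_mul_distrib]
      refine Finset.prod_congr rfl fun j _ => ?_
      split_ifs <;> simp
    simp only [h1]
    rw [← Fintype.prod_sum fun (_ : Fin n) (b : Bool) =>
      if b = true then T (-ε) * kauffmanD else T ε]
    simp [add_comm]
  rw [eq_sub_iff_add_eq, ← hall, ← siteSum_false, siteSum, siteSum, Finset.mul_sum,
    ← Finset.sum_filter_add_sum_filter_not Finset.univ
      fun χ : Fin n → Bool => decide (trueCount χ ≠ 0) = true]
  congr 1
  · refine Finset.sum_congr rfl fun χ hχ => ?_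
    have h : trueCount χ ≠ 0 := by simpa using hχ
    rw [mul_left_comm, ← pow_succ', Nat.sub_add_cancel (Nat.pos_of_ne_zero h)]
  · refine Finset.sum_congr (by ext; simp) fun χ hχ => ?_
    have h : trueCount χ = 0 := by simpa using hχ
    rw [h]

variable {ε}

theorem norm_circleEval_siteSum_false (θ : ℝ) : ‖circleEval (siteSum n ε false) θ‖ = 1 := by
  rw [siteSum_false, circleEval, map_pow, ← circleEval, norm_pow, norm_circleEval_T, one_pow]

/-- As `A + A⁻¹ d = -A⁻³`, the contribution of a twist site is bounded independently of the number of
its crossings, once it is multiplied by `d`. -/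
theorem norm_circleEval_kauffmanD_mul_siteSum_true (hε : ε = 1 ∨ ε = -1) (θ : ℝ) :
    ‖circleEval (kauffmanD * siteSum n ε true) θ‖ ≤ 2 := by
  have h : (T ε + T (-ε) * kauffmanD : ℂ[T;T⁻¹]) = -T (-3 * ε) := by
    rw [kauffmanD, mul_sub, mul_neg, ← T_add, ← T_add]
    rcases hε with rfl | rfl
    · norm_num
    · norm_num
      ring
  rw [kauffmanD_mul_siteSum_true, h]
  have h2 : circleEval ((-T (-3 * ε)) ^ n - T ε ^ n) θ =
      (-circleEval (T (-3 * ε)) θ) ^ n - circleEval (T ε) θ ^ n := by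
    simp only [circleEval, map_sub, map_pow, map_neg]
  rw [h2]
  refine (norm_sub_le _ _).trans ?_
  rw [norm_pow, norm_pow, norm_neg, norm_circleEval_T, norm_circleEval_T]
  norm_num

end SiteSum

namespace EmbeddedGraph

variable {k : ℕ} {G : EmbeddedGraph k} (color : Fin k → TwistColor)

/-- The exponent of `A` for a smoothing that keeps the rails, at a crossing with the sign of `n` in a
twist site of color `c`. -/
def keepSign (c : TwistColor) (n : ℤ) : ℤ := if cutsRails c n false then 1 else -1

theorem keepSign_eq (c : TwistColor) (n : ℤ) : keepSign c n = 1 ∨ keepSign c n = -1 := by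
  unfold keepSign
  split_ifs <;> simp

theorem smoothingSign_eq (c : TwistColor) (n : ℤ) (b : Bool) :
    (if cutsRails c n b then 1 else -1 : ℤ) = if b = true then -keepSign c n else keepSign c n := by
  cases c <;> by_cases h : 0 ≤ n <;> cases b <;> simp [keepSign, cutsRails, h]

/-- The sites with a cut are those that count in the weight of the set of merged edges. -/
theorem treeWeight_mergedOf (κ : Fin k → Bool) :
    treeWeight color (mergedOf color κ) = (Finset.univ.filter fun i => κ i = true).card := by
  classical
  unfold treeWeight
  rw [← Finset.card_union_of_disjoint]
  · congr 1
    ext i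
    simp only [mergedOf, Finset.mem_union, Finset.mem_filter, Finset.mem_univ, true_and]
    cases color i <;> simp
  · rw [Finset.disjoint_filter]
    tauto

theorem one_le_numBoundary (hG : G.Connected) (M : Finset (Fin k)) : 1 ≤ G.numBoundary M := by
  obtain ⟨v⟩ := hG.nonempty
  unfold numBoundary
  by_cases h : ∃ a, G.src a = v
  · obtain ⟨a, -⟩ := h
    have : Nonempty (G.boundaryPerm M).Orbits := ⟨Quot.mk _ a⟩
    have := Nat.card_pos (α := (G.boundaryPerm M).Orbits)
    omega
  · push Not at h
    have : Nonempty G.Isolated := ⟨⟨v, h⟩⟩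
    have := Nat.card_pos (α := G.Isolated)
    omega

/-- The bijection between the choices of cuts and the states of `D_t`. -/
def railStateEquiv (t : Fin k → ℤ) :
    (∀ i, Fin (t i).natAbs → Bool) ≃ (TwistCrossing t → Bool) where
  toFun χ := railState color χ
  invFun s i j := cutsRails (color i) (t i) (s ⟨i, j⟩)
  left_inv χ := by
    funext i j
    exact cutsRails_cutsRails _ _ _
  right_inv s := by
    funext x
    exact cutsRails_cutsRails _ _ _

theorem bracket_diagram_eq_sum_states (t : Fin k → ℤ) :
    (G.diagram color t).bracket = ∑ s : TwistCrossing t → Bool,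
      (∏ x, T (if s x then 1 else -1)) * kauffmanD ^ ((G.diagram color t).loops s - 1) := by
  unfold LinkDiagram.bracket
  exact Finset.sum_congr (congrArg (@Finset.univ (TwistCrossing t → Bool)) (Subsingleton.elim _ _))
    fun s _ => rfl

/-- The state sum, arranged by the set of twist sites that have a cut. -/
theorem bracket_diagram (hG : G.Connected) (t : Fin k → ℤ) :
    (G.diagram color t).bracket = ∑ κ : Fin k → Bool,
      kauffmanD ^ (G.numBoundary (mergedOf color κ) - 1) *
        ∏ i, siteSum (t i).natAbs (keepSign (color i) (t i)) (κ i) := by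
  classical
  let κ : (∀ i, Fin (t i).natAbs → Bool) → Fin k → Bool :=
    fun χ i => decide (trueCount (χ i) ≠ 0)
  let w : ∀ i, (Fin (t i).natAbs → Bool) → ℂ[T;T⁻¹] := fun i χ =>
    (∏ j, T (if χ j = true then -keepSign (color i) (t i) else keepSign (color i) (t i))) *
      kauffmanD ^ (trueCount χ - 1)
  have h1 : (G.diagram color t).bracket = ∑ χ : ∀ i, Fin (t i).natAbs → Bool,
      kauffmanD ^ (G.numBoundary (mergedOf color (κ χ)) - 1) * ∏ i, w i (χ i) := by
    rw [bracket_diagram_eq_sum_states]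
    symm
    refine Fintype.sum_equiv (railStateEquiv color t) _ _ fun χ => ?_
    have h2 : (∏ x : TwistCrossing t, T (if railState color χ x then 1 else -1) : ℂ[T;T⁻¹]) =
        ∏ i, ∏ j, T (if χ i j = true then -keepSign (color i) (t i)
          else keepSign (color i) (t i)) := by
      rw [Fintype.prod_sigma]
      refine Finset.prod_congr rfl fun i _ => Finset.prod_congr rfl fun j _ => ?_
      rw [← smoothingSign_eq]
      rfl
    have h5 : railStateEquiv color t χ = railState color χ := rfl
    have h3 := one_le_numBoundary hG (mergedOf color (κ χ))
    rw [h5, h2, loops_railState, mergedEdges, Nat.sub_add_comm h3, pow_add,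
      Finset.prod_mul_distrib, Finset.prod_pow_eq_pow_sum]
    ring
  rw [h1, ← Finset.sum_fiberwise Finset.univ κ]
  refine Finset.sum_congr rfl fun κ₀ _ => ?_
  have h4 : (Finset.univ.filter fun χ => κ χ = κ₀) = Fintype.piFinset fun i =>
      Finset.univ.filter fun χ : Fin (t i).natAbs → Bool =>
        decide (trueCount χ ≠ 0) = κ₀ i := by
    ext χ
    simp only [Finset.mem_filter, Finset.mem_univ, true_and, Fintype.mem_piFinset, funext_iff, κ]
  simp only [siteSum]
  rw [Finset.prod_univ_sum, Finset.mul_sum, h4]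
  refine Finset.sum_congr rfl fun χ hχ => ?_
  rw [← h4, Finset.mem_filter] at hχ
  rw [hχ.2]

/-- Planarity provides enough factors `d` to bound the contribution of each twist site. -/
theorem norm_circleEval_le (hG : G.Connected) (hplane : G.IsPlane) (t : Fin k → ℤ) (θ : ℝ) :
    ‖circleEval (kauffmanD ^ G.maxTreeWeight color * (G.diagram color t).bracket) θ‖ ≤
      ∑ κ : Fin k → Bool, 2 ^ (G.maxTreeWeight color + (G.numBoundary (mergedOf color κ) - 1)) := by
  rw [bracket_diagram color hG, Finset.mul_sum, circleEval, map_sum]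
  refine (norm_sum_le _ _).trans (Finset.sum_le_sum fun κ _ => ?_)
  set p := G.maxTreeWeight color
  set b := G.numBoundary (mergedOf color κ)
  set K := Finset.univ.filter fun i => κ i = true with hK
  have hle : K.card ≤ p + (b - 1) := by
    have h1 := treeWeight_add_one_le_maxTreeWeight_add_numBoundary hG hplane color
      (mergedOf color κ)
    have h2 := one_le_numBoundary hG (mergedOf color κ)
    rw [treeWeight_mergedOf, ← hK] at h1
    omega
  have hsplit : kauffmanD ^ p * (kauffmanD ^ (b - 1) *
      ∏ i, siteSum (t i).natAbs (keepSign (color i) (t i)) (κ i)) =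
      kauffmanD ^ (p + (b - 1) - K.card) * ∏ i, (if κ i = true then kauffmanD else 1) *
        siteSum (t i).natAbs (keepSign (color i) (t i)) (κ i) := by
    rw [Finset.prod_mul_distrib, ← Finset.prod_filter, Finset.prod_const, ← hK, ← mul_assoc,
      ← mul_assoc, ← pow_add, ← pow_add, Nat.sub_add_cancel hle]
  rw [hsplit, map_mul, map_pow, map_prod, norm_mul, norm_pow, norm_prod]
  have hsite : ∀ i, ‖circleEval ((if κ i = true then kauffmanD else 1) *
      siteSum (t i).natAbs (keepSign (color i) (t i)) (κ i)) θ‖ ≤ if κ i = true then 2 else 1 := by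
    intro i
    cases κ i with
    | true => simpa using norm_circleEval_kauffmanD_mul_siteSum_true _ (keepSign_eq _ _) θ
    | false => simpa using (norm_circleEval_siteSum_false _ θ).le
  calc _ ≤ (2 : ℝ) ^ (p + (b - 1) - K.card) * ∏ i, if κ i = true then (2 : ℝ) else 1 :=
        mul_le_mul (pow_le_pow_left₀ (norm_nonneg _) (norm_circleEval_kauffmanD_le θ) _)
          (Finset.prod_le_prod (fun _ _ => norm_nonneg _) fun i _ => hsite i)
          (Finset.prod_nonneg fun _ _ => norm_nonneg _) (by positivity)
    _ = 2 ^ (p + (b - 1)) := by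
        rw [← Finset.prod_filter, Finset.prod_const, ← hK, ← pow_add, Nat.sub_add_cancel hle]

end EmbeddedGraph

theorem mainTheorem2 (k : ℕ) (G : EmbeddedGraph k) (hG : G.Connected) (hplane : G.IsPlane)
    (color : Fin k → TwistColor) :
    -- `d` is cyclotomic up to a unit
    LaurentPolynomial.T 2 * kauffmanD =
        -Polynomial.toLaurent (Polynomial.cyclotomic 8 ℂ) ∧
    -- the bounds, with a constant that does not depend on `t`
    (∃ C : ℝ, 0 < C ∧ ∀ t : Fin k → ℤ,
      (G.diagram color t).bracket.mahlerMeasure =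
          (kauffmanD ^ G.maxTreeWeight color * (G.diagram color t).bracket).mahlerMeasure ∧
      (kauffmanD ^ G.maxTreeWeight color * (G.diagram color t).bracket).mahlerMeasure ≤
          (kauffmanD ^ G.maxTreeWeight color * (G.diagram color t).bracket).l2Norm ∧
      (0 < G.maxTreeWeight color →
        (kauffmanD ^ G.maxTreeWeight color * (G.diagram color t).bracket).mahlerMeasure <
          (kauffmanD ^ G.maxTreeWeight color * (G.diagram color t).bracket).l2Norm) ∧
      (kauffmanD ^ G.maxTreeWeight color * (G.diagram color t).bracket).l2Norm < C) ∧
    -- `p` is at most the number of twist sites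
    G.maxTreeWeight color ≤ k ∧
    -- `p` is at most the twist number of any diagram of which the colored graph is a template
    (∀ t : Fin k → ℤ, (∀ i, t i ≠ 0) →
      (∀ x y : (G.diagram color t).Crossing,
        (G.diagram color t).TwistEquivalent x y → x.1 = y.1) →
      G.maxTreeWeight color ≤ (G.diagram color t).twistNumber) := by
  refine ⟨T_two_mul_kauffmanD, ⟨(∑ κ : Fin k → Bool,
    2 ^ (G.maxTreeWeight color + (G.numBoundary (EmbeddedGraph.mergedOf color κ) - 1))) + 1,
    by positivity, fun t => ?_⟩, EmbeddedGraph.maxTreeWeight_le color,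
    EmbeddedGraph.maxTreeWeight_le_twistNumber color⟩
  have hne : kauffmanD ^ G.maxTreeWeight color * (G.diagram color t).bracket ≠ 0 :=
    mul_ne_zero (pow_ne_zero _ kauffmanD_ne_zero) (G.diagram color t).bracket_ne_zero
  refine ⟨?_, ?_, fun hp => ?_, ?_⟩
  · rw [mahlerMeasure_mul, mahlerMeasure_pow, mahlerMeasure_kauffmanD, one_pow, one_mul]
  · exact (mahlerMeasure_lt_l2Norm_or hne).elim le_of_lt fun h => h.1.le
  · refine (mahlerMeasure_lt_l2Norm_or hne).resolve_right fun h => h.2 (1 / 8) (by norm_num) ?_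
    have h8 := circleEval_kauffmanD_eighth
    rw [circleEval] at h8
    rw [circleEval, map_mul, map_pow, h8, zero_pow hp.ne', zero_mul]
  · exact (l2Norm_le (by positivity)
      (EmbeddedGraph.norm_circleEval_le color hG hplane t)).trans_lt (lt_add_one _)

end
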